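/- Let $\Lambda_{24}\subset\mathbb{R}^{24}$ be the Leech lattice, scaled so that its minimal vectors (its shortest nonzero vectors) satisfy $\langle x,x\rangle=4$, and let $\mathcal{C}$ be the set of its minimal vectors (there are $196560$ of them). Let $S\subseteq\mathcal{C}$ be any subset such that $\langle x,y\rangle\le 1$ for all distinct $x,y\in S$, and put $S_1=S$. Then there are subsets $S_2,S_3,\ldots\subseteq\mathcal{C}$ such that the sets $S_1,S_2,S_3,\ldots$ are pairwise disjoint, and such that for every $i\ge 1$ we have $\langle x,y\rangle\le 1$ for all distinct $x,y\in S_i$ and $$|S_i|\ \ge\ |S|\left(1-\frac{\sum_{j=1}^{i-1}|S_j|}{196560}\right).$$ Furthermore, if $S$ is antipodal (that is, $-x\in S$ whenever $x\in S$), then $S_2,S_3,\ldots$ can be taken to be antipodal as well. (The sets $S_i$ may be empty.) -/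

import Mathlib

/-- The 24 coordinate positions: the projective line over `𝔽₂₃`, with `none` as the point `∞`. -/
abbrev LeechIndex : Type := Option (ZMod 23)

/-- `ℝ²⁴` with its Euclidean structure. -/
abbrev LeechSpace : Type := EuclideanSpace ℝ LeechIndex

/-- The standard spanning words of the binary Golay code. Let `N ⊆ 𝔽₂₃` consist of `0` and the
quadratic nonresidues. The word with index `i ∈ 𝔽₂₃` is the indicator function of
`{n - i | n ∈ N}`, and the word with index `∞` is the all-ones word. -/
def golayWord : LeechIndex → LeechIndex → ZMod 2
  | none, _ => 1
  | some _, none => 0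
  | some i, some k => if ¬ IsSquare (k + i) ∨ k + i = 0 then 1 else 0

/-- The extended binary Golay code, as the extended quadratic residue code of length 24. -/
def golayCode : Submodule (ZMod 2) (LeechIndex → ZMod 2) :=
  Submodule.span (ZMod 2) (Set.range golayWord)

/-- The Leech lattice `Λ₂₄` in its standard coordinates, scaled to have minimal norm `⟪v, v⟫ = 4`:
the vectors `(x₁, …, x₂₄) / √8` with integers `xᵢ = m + 2 yᵢ` all of the parity of `m`, such that
`y` modulo 2 is a word of the Golay code and `∑ xᵢ ≡ 4 m` modulo 8. -/
noncomputable def leechLattice : AddSubgroup LeechSpace where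
  carrier := {v | ∃ (m : ℤ) (y : LeechIndex → ℤ),
    (fun i => (y i : ZMod 2)) ∈ golayCode ∧
    (∑ i, (m + 2 * y i)) ≡ 4 * m [ZMOD 8] ∧
    ∀ i, v i = ((m + 2 * y i : ℤ) : ℝ) / Real.sqrt 8}
  zero_mem' := ⟨0, 0, by simp only [Pi.zero_apply, Int.cast_zero]; exact golayCode.zero_mem, by simp, by simp⟩
  add_mem' := by
    rintro v w ⟨m, y, hy, hs, hv⟩ ⟨n, z, hz, ht, hw⟩
    refine ⟨m + n, y + z, ?_, ?_, fun i => ?_⟩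
    · simpa [Pi.add_def] using golayCode.add_mem hy hz
    · have h := hs.add ht
      rw [← Finset.sum_add_distrib, ← mul_add] at h
      convert h using 1
      exact Finset.sum_congr rfl fun i _ => by rw [Pi.add_apply]; ring
    · simp only [PiLp.add_apply, hv, hw, Pi.add_apply]
      push_cast
      ring
  neg_mem' := by
    rintro v ⟨m, y, hy, hs, hv⟩
    refine ⟨-m, -y, ?_, ?_, fun i => ?_⟩
    · simpa [Pi.neg_def] using golayCode.neg_mem hy
    · have h := hs.neg
      rw [← Finset.sum_neg_distrib, ← mul_neg] at h
      convert h using 1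
      exact Finset.sum_congr rfl fun i _ => by rw [Pi.neg_apply]; ring
    · simp only [PiLp.neg_apply, hv, Pi.neg_apply]
      push_cast
      ring

/-- The minimal vectors of the Leech lattice: its shortest nonzero vectors. -/
def leechMinimalVectors : Set LeechSpace :=
  {v | v ∈ leechLattice ∧ v ≠ 0 ∧ ∀ w ∈ leechLattice, w ≠ 0 → ‖v‖ ≤ ‖w‖}

/-- Distinct elements of `S` have inner product at most `1`. -/
def InnerLeOne (S : Set LeechSpace) : Prop :=
  ∀ x ∈ S, ∀ y ∈ S, x ≠ y → inner ℝ x y ≤ 1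

/-- A set of vectors is antipodal if it is closed under negation. -/
def IsAntipodal (S : Set LeechSpace) : Prop :=
  ∀ x ∈ S, -x ∈ S

/-! Let `G` be a finite group acting transitively on `𝒞` and preserving inner products. For `U ⊆ 𝒞`
the mean over `g ∈ G` of `|gS \ U|` is `|S| (1 - |U| / |𝒞|)`, so some `g` reaches it
(`exists_smul_card_filter_ge`). Taking for `U` the union of the sets already chosen and `gS \ U` as
the next set gives disjointness and the cardinality bound. Inner products at most `1` are inherited
from `S`, and so is antipodality, since `g` commutes with negation and `U` is antipodal by
induction.

The work lies in transitivity and in `|𝒞| ≥ 196560`; the reverse inequality is not needed, because a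
larger `𝒞` only improves the bound. Vectors are multiplied by `√8`, so that `𝒞` becomes the integral
shell of norm 32 (`leechMinimalVectors_eq`, resting on `IsLeech.norm_ge`). The group consists of all
permutations of the shell that preserve inner products.

Transitivity (`shellRel_of_mem`) uses two kinds of isometry: sign changes on Golay words and
Conway's sextet maps. They carry an odd vector to an even one, an even one to one divisible by 4,
and the latter to a vector with two entries 4; sextet maps then move the pair of positions. The
combinatorial input is the Steiner system of octads, obtained from the finitely many weights of the
Golay code. -/

/-! ### The Golay code, computed on bit masks. -/

/-- The bit position of a coordinate; `∞` is the bit 23. -/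
def bitPos : LeechIndex → ℕ
  | none => 23
  | some k => k.val

/-- The set of coordinates encoded by a bit mask. -/
def maskSet (m : ℕ) : Finset LeechIndex := Finset.univ.filter fun i => m.testBit (bitPos i)

/-- The binary word with support `s`. -/
def wordOf (s : Finset LeechIndex) : LeechIndex → ZMod 2 := fun i => if i ∈ s then 1 else 0

/-- The supports of the words of the Golay code. -/
def IsGolay (s : Finset LeechIndex) : Prop := wordOf s ∈ golayCode

/-- Bit masks of the spanning words of the Golay code. -/
def golayMasks : List ℕ :=
  [8047777, 8218192, 4109096, 2054548, 1027274, 513637, 4451122, 2225561, 5307084, 2653542,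
   1326771, 4857689, 6623148, 3311574, 1655787, 5022197, 6705402, 3352701, 5870654, 2935327,
   5661967, 7025287, 7706947, 16777215]

/-- Bit masks of a systematic basis of the Golay code. -/
def golayBasis : List ℕ :=
  [11415553, 14442498, 1503236, 3006472, 6012944, 10072096, 11755584, 15122560, 6533376,
   15290880, 8164352, 14096384]

/-- Each basis mask as a sum of spanning words, given by their indices. -/
def golayBasisCombination : List (List ℕ) :=
  [[1, 2, 4, 7, 9, 10, 23], [0, 1, 3, 6, 8, 9, 23], [1, 6, 9], [0, 5, 8], [0, 5, 6, 7, 8, 10],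
   [0, 1, 2, 4, 8, 23], [1, 3, 4, 5, 6, 7, 8, 10, 23], [0, 2, 3, 4, 5, 6, 7, 9, 23], [0, 3, 4,
   7, 9], [0, 1, 3, 5, 7, 9, 23], [1, 4, 5, 7, 9], [0, 1, 2, 3, 6, 7, 8, 9, 10, 23]]

/-- The systematic encoder of the Golay code on bit masks. -/
def golayEncode (n : ℕ) : ℕ :=
  (List.range 12).foldr (fun j m => if n.testBit j then golayBasis.getD j 0 ^^^ m else m) 0

theorem bitPos_lt (i : LeechIndex) : bitPos i < 24 := by
  cases i with
  | none => simp [bitPos]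
  | some k => have := ZMod.val_lt k; simp only [bitPos]; omega

theorem wordOf_symmDiff (s t : Finset LeechIndex) :
    wordOf (symmDiff s t) = wordOf s + wordOf t := by
  funext i
  simp only [wordOf, Finset.mem_symmDiff, Pi.add_apply]
  by_cases hs : i ∈ s <;> by_cases ht : i ∈ t <;> simp [hs, ht]
  decide

theorem wordOf_injective : Function.Injective wordOf := by
  intro s t h
  ext i
  have := congrFun h i
  simp only [wordOf] at this
  by_cases hs : i ∈ s <;> by_cases ht : i ∈ t <;> simp [hs, ht] at this ⊢

theorem exists_wordOf (c : LeechIndex → ZMod 2) :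
    c = wordOf (Finset.univ.filter fun i => c i = 1) := by
  funext i
  simp only [wordOf, Finset.mem_filter, Finset.mem_univ, true_and]
  split_ifs with h
  · exact h
  · revert h; generalize c i = z; revert z; decide

theorem IsGolay.symmDiff {s t : Finset LeechIndex} (hs : IsGolay s) (ht : IsGolay t) :
    IsGolay (symmDiff s t) := by
  unfold IsGolay
  rw [wordOf_symmDiff]
  exact golayCode.add_mem hs ht

theorem isGolay_empty : IsGolay ∅ := by
  have : wordOf ∅ = 0 := by funext i; simp [wordOf]
  unfold IsGolay
  rw [this]
  exact golayCode.zero_mem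

theorem isGolay_univ : IsGolay Finset.univ := by
  have : wordOf Finset.univ = golayWord none := by funext i; simp [wordOf, golayWord]
  unfold IsGolay
  rw [this]
  exact Submodule.subset_span ⟨none, rfl⟩

theorem maskSet_xor (a b : ℕ) : maskSet (a ^^^ b) = symmDiff (maskSet a) (maskSet b) := by
  ext i
  simp only [maskSet, Finset.mem_symmDiff, Finset.mem_filter, Finset.mem_univ, true_and,
    Nat.testBit_xor]
  cases a.testBit (bitPos i) <;> cases b.testBit (bitPos i) <;> simp

theorem maskSet_zero : maskSet 0 = ∅ := by
  ext i; simp [maskSet]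

theorem golayWord_eq_wordOf (i : LeechIndex) :
    golayWord i = wordOf (maskSet (golayMasks.getD (bitPos i) 0)) := by
  have key : ∀ i k : LeechIndex, golayWord i k =
      if (golayMasks.getD (bitPos i) 0).testBit (bitPos k) then 1 else 0 := by
    decide +kernel
  funext k
  simp [wordOf, maskSet, key]

theorem isGolay_maskSet_golayMasks {n : ℕ} (hn : n < 24) :
    IsGolay (maskSet (golayMasks.getD n 0)) := by
  have key : ∀ n < 24, ∃ i, bitPos i = n := by decide +kernel
  obtain ⟨i, rfl⟩ := key n hn
  unfold IsGolay
  rw [← golayWord_eq_wordOf]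
  exact Submodule.subset_span ⟨i, rfl⟩

theorem isGolay_maskSet_foldr (l : List ℕ) (hl : ∀ n ∈ l, n < 24) :
    IsGolay (maskSet (l.foldr (fun n m => golayMasks.getD n 0 ^^^ m) 0)) := by
  induction l with
  | nil => simpa [maskSet_zero] using isGolay_empty
  | cons a l ih =>
    rw [List.foldr_cons, maskSet_xor]
    exact (isGolay_maskSet_golayMasks (hl a (by simp))).symmDiff
      (ih fun n hn => hl n (by simp [hn]))

theorem isGolay_maskSet_golayBasis {j : ℕ} (hj : j < 12) :
    IsGolay (maskSet (golayBasis.getD j 0)) := by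
  have key : ∀ j < 12, golayBasis.getD j 0 = (golayBasisCombination.getD j []).foldr
      (fun n m => golayMasks.getD n 0 ^^^ m) 0 := by decide +kernel
  have bound : ∀ j < 12, ∀ n ∈ golayBasisCombination.getD j [], n < 24 := by decide +kernel
  rw [key j hj]
  exact isGolay_maskSet_foldr _ (bound j hj)

theorem isGolay_maskSet_golayEncode (n : ℕ) : IsGolay (maskSet (golayEncode n)) := by
  have key : ∀ l : List ℕ, (∀ j ∈ l, j < 12) → IsGolay (maskSet (l.foldr
      (fun j m => if n.testBit j then golayBasis.getD j 0 ^^^ m else m) 0)) := by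
    intro l hl
    induction l with
    | nil => simpa [maskSet_zero] using isGolay_empty
    | cons a l ih =>
      rw [List.foldr_cons]
      have h := ih fun n hn => hl n (by simp [hn])
      split_ifs
      · rw [maskSet_xor]
        exact (isGolay_maskSet_golayBasis (hl a (by simp))).symmDiff h
      · exact h
  exact key _ fun j hj => List.mem_range.1 hj

theorem golayEncode_xor (a b : ℕ) : golayEncode (a ^^^ b) = golayEncode a ^^^ golayEncode b := by
  unfold golayEncode
  induction List.range 12 with
  | nil => simp
  | cons j l ih =>
    rw [List.foldr_cons, List.foldr_cons, List.foldr_cons, ih, Nat.testBit_xor]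
    generalize List.foldr _ 0 l = x, List.foldr _ 0 l = y
    cases a.testBit j <;> cases b.testBit j <;> simp [Nat.xor_assoc, Nat.xor_left_comm]

/-- The image of the encoder is closed under addition by `golayEncode_xor`. It contains each
spanning word because the encoder is systematic: the low twelve bits of a word are its message. -/
theorem IsGolay.exists_golayEncode {s : Finset LeechIndex} (hs : IsGolay s) :
    ∃ n < 4096, s = maskSet (golayEncode n) := by
  have key : ∀ c ∈ golayCode, ∃ n < 4096, c = wordOf (maskSet (golayEncode n)) := by
    intro c hc
    induction hc using Submodule.span_induction with
    | mem c h =>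
      obtain ⟨i, rfl⟩ := h
      have henc : ∀ n < 24, golayEncode (golayMasks.getD n 0 % 4096) = golayMasks.getD n 0 := by
        decide +kernel
      exact ⟨_, Nat.mod_lt _ (by norm_num), by
        rw [golayWord_eq_wordOf, henc _ (bitPos_lt i)]⟩
    | zero =>
      refine ⟨0, by norm_num, ?_⟩
      have : golayEncode 0 = 0 := by decide +kernel
      rw [this, maskSet_zero]
      funext i; simp [wordOf]
    | add c d _ _ hc hd =>
      obtain ⟨a, ha, rfl⟩ := hc
      obtain ⟨b, hb, rfl⟩ := hd
      exact ⟨a ^^^ b, Nat.xor_lt_two_pow (n := 12) ha hb, by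
        rw [golayEncode_xor, maskSet_xor, wordOf_symmDiff]⟩
    | smul r c _ hc =>
      have hr : r = 0 ∨ r = 1 := by revert r; decide
      rcases hr with rfl | rfl
      · refine ⟨0, by norm_num, ?_⟩
        have : golayEncode 0 = 0 := by decide +kernel
        rw [this, maskSet_zero]
        funext i; simp [wordOf]
      · simpa using hc
  obtain ⟨n, hn, h⟩ := key _ hs
  exact ⟨n, hn, wordOf_injective h⟩

/-- The number of ones among the lowest 24 bits. -/
def popCount (m : ℕ) : ℕ := ((List.range 24).map fun i => (m.testBit i).toNat).sum

theorem card_maskSet (m : ℕ) : (maskSet m).card = popCount m := by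
  have h1 : (maskSet m).card = ∑ i : LeechIndex, (m.testBit (bitPos i)).toNat := by
    rw [maskSet, Finset.card_filter]
    exact Finset.sum_congr rfl fun i _ => by cases m.testBit (bitPos i) <;> simp
  have h2 : ∑ k : ZMod 23, (m.testBit k.val).toNat =
      ∑ k ∈ Finset.range 23, (m.testBit k).toNat :=
    Fin.sum_univ_eq_sum_range (fun k => (m.testBit k).toNat) 23
  have h3 : ∀ (n : ℕ) (f : ℕ → ℕ), ∑ k ∈ Finset.range n, f k = ((List.range n).map f).sum :=
    fun _ _ => rfl
  rw [h1, Fintype.sum_option]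
  simp only [bitPos]
  rw [h2, add_comm, ← Finset.sum_range_succ (fun k => (m.testBit k).toNat) 23]
  exact h3 _ _

/-- The encoder reaches every word, so this is a finite check over the messages `64 * a + b`. -/
theorem IsGolay.card_mem {s : Finset LeechIndex} (hs : IsGolay s) :
    s.card ∈ [0, 8, 12, 16, 24] := by
  have key : ∀ a < 64, ∀ b < 64, popCount (golayEncode (64 * a + b)) ∈ [0, 8, 12, 16, 24] := by
    decide +kernel
  obtain ⟨n, hn, rfl⟩ := hs.exists_golayEncode
  rw [card_maskSet]
  have := key (n / 64) (by omega) (n % 64) (by omega)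
  rwa [Nat.div_add_mod] at this

theorem IsGolay.four_dvd {s : Finset LeechIndex} (hs : IsGolay s) : 4 ∣ s.card := by
  have := hs.card_mem
  simp only [List.mem_cons, List.not_mem_nil, or_false] at this
  omega

theorem IsGolay.eight_le {s : Finset LeechIndex} (hs : IsGolay s) (hne : s.Nonempty) :
    8 ≤ s.card := by
  have := hs.card_mem
  have := hne.card_pos
  simp only [List.mem_cons, List.not_mem_nil, or_false] at *
  omega

open Classical in
/-- The supports of all words of the Golay code. -/
noncomputable def golaySets : Finset (Finset LeechIndex) := Finset.univ.filter IsGolay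

open Classical in
/-- The octads: supports of the words of weight 8. -/
noncomputable def octads : Finset (Finset LeechIndex) :=
  Finset.univ.filter fun s => IsGolay s ∧ s.card = 8

theorem mem_golaySets {s : Finset LeechIndex} : s ∈ golaySets ↔ IsGolay s := by
  simp [golaySets]

theorem mem_octads {s : Finset LeechIndex} : s ∈ octads ↔ IsGolay s ∧ s.card = 8 := by
  simp [octads]

theorem maskSet_golayEncode_injOn :
    Set.InjOn (fun n => maskSet (golayEncode n)) {n | n < 4096} := by
  have key : ∀ a < 64, ∀ b < 64, golayEncode (64 * a + b) % 4096 = 64 * a + b := by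
    decide +kernel
  have key' : ∀ n < 4096, golayEncode n % 4096 = n := by
    intro n hn
    have := key (n / 64) (by omega) (n % 64) (by omega)
    rwa [Nat.div_add_mod] at this
  have pos : ∀ j < 12, ∃ i, bitPos i = j := by decide +kernel
  intro a ha b hb h
  rw [← key' a ha, ← key' b hb]
  refine Nat.eq_of_testBit_eq fun j => ?_
  rw [show 4096 = 2 ^ 12 by norm_num, Nat.testBit_mod_two_pow, Nat.testBit_mod_two_pow]
  by_cases hj : j < 12
  · obtain ⟨i, rfl⟩ := pos j hj
    have := Finset.ext_iff.1 h i
    simp only [maskSet, Finset.mem_filter, Finset.mem_univ, true_and] at this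
    rw [Bool.eq_iff_iff.2 this]
  · simp [hj]

theorem card_golaySets : 4096 ≤ golaySets.card := by
  rw [← Finset.card_range 4096]
  refine Finset.card_le_card_of_injOn (fun n => maskSet (golayEncode n)) (fun n _ => ?_) ?_
  · exact mem_golaySets.2 (isGolay_maskSet_golayEncode n)
  · exact maskSet_golayEncode_injOn.mono fun n hn => by simpa using hn

theorem card_octads : 759 ≤ octads.card := by
  have key : ((List.range 4096).filter fun n => popCount (golayEncode n) = 8).length = 759 := by
    decide +kernel
  have hnd : ((List.range 4096).filter fun n => popCount (golayEncode n) = 8).Nodup :=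
    List.nodup_range.filter _
  rw [← key, ← List.toFinset_card_of_nodup hnd]
  refine Finset.card_le_card_of_injOn (fun n => maskSet (golayEncode n)) (fun n hn => ?_) ?_
  · simp only [List.coe_toFinset, Set.mem_ofPred_eq, List.mem_filter, decide_eq_true_eq] at hn
    exact mem_octads.2 ⟨isGolay_maskSet_golayEncode n, by rw [card_maskSet, hn.2]⟩
  · refine maskSet_golayEncode_injOn.mono fun n hn => ?_
    simp only [List.coe_toFinset, Set.mem_ofPred_eq, List.mem_filter, List.mem_range] at hn
    exact hn.1

/-! ### Octads as a Steiner system, and sextets. -/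

theorem card_leechIndex : Fintype.card LeechIndex = 24 := by
  simp [LeechIndex, ZMod.card]

theorem card_symmDiff_add {α : Type*} [DecidableEq α] (s t : Finset α) :
    (symmDiff s t).card + 2 * (s ∩ t).card = s.card + t.card := by
  have h : symmDiff s t = (s \ t) ∪ (t \ s) := rfl
  rw [h, Finset.card_union_of_disjoint (disjoint_sdiff_sdiff)]
  have h1 := Finset.card_sdiff_add_card_inter s t
  have h2 := Finset.card_sdiff_add_card_inter t s
  rw [Finset.inter_comm t s] at h2
  omega

/-- In `|s ∆ t| + 2 |s ∩ t| = |s| + |t|` all three weights of words are divisible by 4. -/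
theorem IsGolay.even_inter {s t : Finset LeechIndex} (hs : IsGolay s) (ht : IsGolay t) :
    Even (s ∩ t).card := by
  have h := card_symmDiff_add s t
  have h1 := hs.four_dvd
  have h2 := ht.four_dvd
  have h3 := (hs.symmDiff ht).four_dvd
  rw [Nat.even_iff]
  omega

/-- The sum of the two words would have weight at most `8 + 8 - 2 * 5 = 6`, below the minimal weight
8. -/
theorem octads_eq_of_card_inter {s t : Finset LeechIndex} (hs : s ∈ octads) (ht : t ∈ octads)
    (h : 5 ≤ (s ∩ t).card) : s = t := by
  rw [mem_octads] at hs ht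
  by_contra hne
  have hpos : (symmDiff s t).Nonempty := Finset.nonempty_iff_ne_empty.2 fun h => hne
    (symmDiff_eq_bot.1 h)
  have := (hs.1.symmDiff ht.1).eight_le hpos
  have := card_symmDiff_add s t
  omega

/-- Octads form a Steiner system `S(5, 8, 24)`. -/
theorem exists_octad_superset {F : Finset LeechIndex} (hF : F.card = 5) :
    ∃ O ∈ octads, F ⊆ O := by
  have hdisj : (octads : Set (Finset LeechIndex)).PairwiseDisjoint (Finset.powersetCard 5) := by
    intro s hs t ht hne
    refine Finset.disjoint_left.2 fun G hGs hGt => hne ?_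
    rw [Finset.mem_powersetCard] at hGs hGt
    refine octads_eq_of_card_inter hs ht ?_
    rw [← hGs.2]
    exact Finset.card_le_card (Finset.subset_inter hGs.1 hGt.1)
  have hsub : octads.biUnion (Finset.powersetCard 5) ⊆ Finset.powersetCard 5 Finset.univ :=
    Finset.biUnion_subset.2 fun s _ => Finset.powersetCard_mono (Finset.subset_univ s)
  have hcard : (octads.biUnion (Finset.powersetCard 5)).card = octads.card * 56 := by
    rw [Finset.card_biUnion hdisj]
    refine Finset.sum_const_nat fun s hs => ?_
    rw [Finset.card_powersetCard, (mem_octads.1 hs).2]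
    decide
  have huniv : (Finset.powersetCard 5 (Finset.univ : Finset LeechIndex)).card = 42504 := by
    rw [Finset.card_powersetCard, Finset.card_univ, card_leechIndex]
    decide
  -- Octads share no 5-subset, and `759 * 56 = 42504 = (24 choose 5)`, so their 5-subsets exhaust
  -- all of them.
  have heq := Finset.eq_of_subset_of_card_le hsub (by
    have := card_octads
    omega)
  have hmem : F ∈ octads.biUnion (Finset.powersetCard 5) := by
    rw [heq]
    exact Finset.mem_powersetCard.2 ⟨Finset.subset_univ _, hF⟩
  obtain ⟨O, hO, h⟩ := Finset.mem_biUnion.1 hmem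
  exact ⟨O, hO, (Finset.mem_powersetCard.1 h).1⟩

theorem exists_notMem_of_card_lt {s : Finset LeechIndex} (hs : s.card < 24) : ∃ i, i ∉ s := by
  by_contra! h
  have : s = Finset.univ := Finset.eq_univ_iff_forall.2 h
  rw [this, Finset.card_univ, card_leechIndex] at hs
  omega

/-- Two different octads through `U` meet only in `U`, so at most one of them contains `b`. The
point `f` outside `O₁` produces the second octad. -/
theorem exists_octad_separating {U : Finset LeechIndex} (hU : U.card = 4) {b : LeechIndex}
    (hb : b ∉ U) : ∃ O ∈ octads, U ⊆ O ∧ b ∉ O := by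
  obtain ⟨e, he⟩ := exists_notMem_of_card_lt (s := insert b U)
    (by rw [Finset.card_insert_of_notMem hb]; omega)
  rw [Finset.mem_insert, not_or] at he
  obtain ⟨O₁, hO₁, h₁⟩ := exists_octad_superset (F := insert e U)
    (by rw [Finset.card_insert_of_notMem he.2, hU])
  obtain ⟨f, hf⟩ := exists_notMem_of_card_lt (s := O₁) (by rw [(mem_octads.1 hO₁).2]; norm_num)
  have hU₁ : U ⊆ O₁ := (Finset.subset_insert _ _).trans h₁
  obtain ⟨O₂, hO₂, h₂⟩ := exists_octad_superset (F := insert f U)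
    (by rw [Finset.card_insert_of_notMem fun h => hf (hU₁ h), hU])
  have hU₂ : U ⊆ O₂ := (Finset.subset_insert _ _).trans h₂
  by_cases hb₁ : b ∈ O₁
  · refine ⟨O₂, hO₂, hU₂, fun hb₂ => hf ?_⟩
    have heq : O₁ = O₂ := by
      refine octads_eq_of_card_inter hO₁ hO₂ ?_
      rw [show 5 = (insert b U).card by rw [Finset.card_insert_of_notMem hb, hU]]
      refine Finset.card_le_card (Finset.insert_subset ?_ (Finset.subset_inter hU₁ hU₂))
      exact Finset.mem_inter.2 ⟨hb₁, hb₂⟩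
    rw [heq]
    exact h₂ (Finset.mem_insert_self _ _)
  · exact ⟨O₁, hO₁, hU₁, hb₁⟩

/-- An octad through three points of `T` and one point outside, avoiding the fourth point of `T`,
meets `T` in exactly three points. -/
theorem exists_golay_odd_inter {T : Finset LeechIndex} (hT : T.card = 4) :
    ∃ O, IsGolay O ∧ Odd (T ∩ O).card := by
  obtain ⟨b, hb⟩ := Finset.card_pos.1 (by omega : 0 < T.card)
  obtain ⟨e, he⟩ := exists_notMem_of_card_lt (s := T) (by omega)
  have hcard : (T.erase b).card = 3 := by rw [Finset.card_erase_of_mem hb, hT]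
  have heb : e ∉ T.erase b := fun h => he (Finset.mem_of_mem_erase h)
  obtain ⟨O, hO, hsub, hbO⟩ := exists_octad_separating (U := insert e (T.erase b)) (b := b)
    (by rw [Finset.card_insert_of_notMem heb, hcard]) (by
      rw [Finset.mem_insert, not_or]
      exact ⟨fun h => he (h ▸ hb), Finset.notMem_erase b T⟩)
  refine ⟨O, (mem_octads.1 hO).1, ?_⟩
  have : T ∩ O = T.erase b := by
    ext i
    rw [Finset.mem_inter, Finset.mem_erase]
    constructor
    · rintro ⟨hi, hiO⟩
      exact ⟨fun h => hbO (h ▸ hiO), hi⟩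
    · rintro ⟨hi, hiT⟩
      exact ⟨hiT, hsub (Finset.mem_insert_of_mem (Finset.mem_erase.2 ⟨hi, hiT⟩))⟩
  rw [this, hcard]
  decide

theorem exists_golay_mem_notMem {a b : LeechIndex} (hab : a ≠ b) :
    ∃ O, IsGolay O ∧ a ∈ O ∧ b ∉ O := by
  obtain ⟨U, haU, hU, hU4⟩ := Finset.exists_subsuperset_card_eq
    (s := {a}) (t := Finset.univ.erase b) (n := 4) (by simpa using hab) (by simp)
    (by rw [Finset.card_erase_of_mem (Finset.mem_univ _), Finset.card_univ, card_leechIndex]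
        norm_num)
  obtain ⟨O, hO, hUO, hb⟩ := exists_octad_separating hU4 (b := b)
    fun h => Finset.notMem_erase b _ (hU h)
  exact ⟨O, (mem_octads.1 hO).1, hUO (haU (Finset.mem_singleton_self a)), hb⟩

/-- The fibres of `τ` are six tetrads, any two of which form an octad. -/
structure IsSextet (τ : LeechIndex → Fin 6) : Prop where
  card_fiber : ∀ a, (Finset.univ.filter fun i => τ i = a).card = 4
  isGolay : ∀ a b, IsGolay (symmDiff (Finset.univ.filter fun i => τ i = a)
    (Finset.univ.filter fun i => τ i = b))

/-- Every tetrad belongs to a sextet. -/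
theorem exists_isSextet {T : Finset LeechIndex} (hT : T.card = 4) :
    ∃ τ, IsSextet τ ∧ ∃ a, (Finset.univ.filter fun i => τ i = a) = T := by
  classical
  have hoct : ∀ e, ∃ O, e ∉ T → O ∈ octads ∧ insert e T ⊆ O := by
    intro e
    by_cases he : e ∈ T
    · exact ⟨∅, fun h => absurd he h⟩
    · obtain ⟨O, hO, h⟩ := exists_octad_superset (F := insert e T)
        (by rw [Finset.card_insert_of_notMem he, hT])
      exact ⟨O, fun _ => ⟨hO, h⟩⟩
  choose O hO using hoct
  have hTO : ∀ e, e ∉ T → T ⊆ O e := fun e he =>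
    (Finset.subset_insert _ _).trans (hO e he).2
  -- The tetrad of a point `e` outside `T` is the rest of the octad through `T` and `e`; uniqueness
  -- of that octad makes these tetrads a partition.
  set B : LeechIndex → Finset LeechIndex := fun e => if e ∈ T then T else O e \ T with hB
  have hBT : ∀ e, e ∈ T → B e = T := fun e he => by simp [hB, he]
  have hBO : ∀ e, e ∉ T → B e = O e \ T := fun e he => by simp [hB, he]
  have hself : ∀ e, e ∈ B e := by
    intro e
    by_cases he : e ∈ T
    · rwa [hBT e he]
    · rw [hBO e he]
      exact Finset.mem_sdiff.2 ⟨(hO e he).2 (Finset.mem_insert_self _ _), he⟩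
  have hcard : ∀ e, (B e).card = 4 := by
    intro e
    by_cases he : e ∈ T
    · rwa [hBT e he]
    · rw [hBO e he, Finset.card_sdiff_of_subset (hTO e he), (mem_octads.1 (hO e he).1).2, hT]
  have heq : ∀ e j, j ∈ B e → B j = B e := by
    intro e j hj
    by_cases he : e ∈ T
    · rw [hBT e he] at hj
      rw [hBT e he, hBT j hj]
    · rw [hBO e he, Finset.mem_sdiff] at hj
      rw [hBO e he, hBO j hj.2]
      congr 1
      refine octads_eq_of_card_inter (hO j hj.2).1 (hO e he).1 ?_
      rw [show 5 = (insert j T).card by rw [Finset.card_insert_of_notMem hj.2, hT]]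
      refine Finset.card_le_card (Finset.subset_inter (hO j hj.2).2 ?_)
      exact Finset.insert_subset hj.1 (hTO e he)
  have hgolT : ∀ e, IsGolay (symmDiff (B e) T) := by
    intro e
    by_cases he : e ∈ T
    · rw [hBT e he, symmDiff_self]
      exact isGolay_empty
    · rw [hBO e he, symmDiff_comm]
      have : symmDiff T (O e \ T) = O e := by
        rw [Disjoint.symmDiff_eq_sup Finset.disjoint_sdiff]
        exact Finset.union_sdiff_of_subset (hTO e he)
      rw [this]
      exact (mem_octads.1 (hO e he).1).1
  have hgol : ∀ e f, IsGolay (symmDiff (B e) (B f)) := by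
    intro e f
    have h := (hgolT e).symmDiff (hgolT f)
    rwa [symmDiff_symmDiff_symmDiff_comm, symmDiff_self, symmDiff_bot] at h
  have hfib : ∀ e, (Finset.univ.filter fun i => B i = B e) = B e := by
    intro e
    ext i
    simp only [Finset.mem_filter, Finset.mem_univ, true_and]
    exact ⟨fun h => h ▸ hself i, heq e i⟩
  have hP : (Finset.univ.image B).card = 6 := by
    have h := Finset.card_eq_sum_card_image B (Finset.univ : Finset LeechIndex)
    rw [Finset.sum_const_nat (m := 4), Finset.card_univ, card_leechIndex] at h
    · omega
    · intro b hb
      obtain ⟨e, -, rfl⟩ := Finset.mem_image.1 hb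
      rw [hfib, hcard]
  set φ := Finset.equivFinOfCardEq hP
  have hmem : ∀ i, B i ∈ Finset.univ.image B := fun i => Finset.mem_image_of_mem _
    (Finset.mem_univ i)
  have hfibτ : ∀ e, (Finset.univ.filter fun i => φ ⟨B i, hmem i⟩ = φ ⟨B e, hmem e⟩) = B e := by
    intro e
    refine Eq.trans ?_ (hfib e)
    ext i
    simp
  have hsurj : ∀ a, ∃ e, a = φ ⟨B e, hmem e⟩ := by
    intro a
    obtain ⟨⟨b, hb⟩, rfl⟩ := φ.surjective a
    obtain ⟨e, -, rfl⟩ := Finset.mem_image.1 hb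
    exact ⟨e, rfl⟩
  refine ⟨fun i => φ ⟨B i, hmem i⟩, ⟨fun a => ?_, fun a b => ?_⟩, ?_⟩
  · obtain ⟨e, rfl⟩ := hsurj a
    rw [hfibτ, hcard]
  · obtain ⟨e, rfl⟩ := hsurj a
    obtain ⟨f, rfl⟩ := hsurj b
    rw [hfibτ, hfibτ]
    exact hgol e f
  · obtain ⟨t, ht⟩ := Finset.card_pos.1 (by omega : 0 < T.card)
    exact ⟨_, (hfibτ t).trans (hBT t ht)⟩

/-- A function that is constant on the tetrads of a sextet, with even total over the six tetrads,
is a word of the Golay code modulo 2. -/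
theorem IsSextet.comp_mem_golayCode {τ : LeechIndex → Fin 6} (hτ : IsSextet τ) (k : Fin 6 → ℤ)
    (hk : Even (∑ a, k a)) : (fun i => (k (τ i) : ZMod 2)) ∈ golayCode := by
  have hk' : (∑ a, (k a : ZMod 2)) = 0 := by
    rw [← Int.cast_sum]
    exact (ZMod.intCast_zmod_eq_zero_iff_dvd _ 2).2 hk.two_dvd
  -- The total of `k` vanishes modulo 2, so adding tetrad `0` that many times changes nothing and
  -- leaves a combination of sums of two tetrads.
  have h : (fun i => (k (τ i) : ZMod 2)) = ∑ a, (k a : ZMod 2) •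
      wordOf (symmDiff (Finset.univ.filter fun i => τ i = a)
        (Finset.univ.filter fun i => τ i = 0)) := by
    funext i
    simp only [wordOf_symmDiff, Finset.sum_apply, Pi.smul_apply, Pi.add_apply, smul_eq_mul,
      mul_add, Finset.sum_add_distrib, ← Finset.sum_mul, hk', zero_mul, add_zero]
    simp [wordOf]
  rw [h]
  exact golayCode.sum_mem fun a _ => golayCode.smul_mem _ (hτ.isGolay a 0)

/-! ### Isometries of the Leech lattice: sign changes and sextet maps. -/

/-- The Leech lattice in integral coordinates, scaled to have minimal norm 32. -/
def IsLeech (x : LeechIndex → ℤ) : Prop :=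
  ∃ (m : ℤ) (y : LeechIndex → ℤ), (fun i => (y i : ZMod 2)) ∈ golayCode ∧
    (∑ i, (m + 2 * y i)) ≡ 4 * m [ZMOD 8] ∧ ∀ i, x i = m + 2 * y i

/-- Maps of integral vectors that act isometrically on the Leech lattice. -/
structure IsLeechIsometry (f : (LeechIndex → ℤ) → LeechIndex → ℤ) : Prop where
  isLeech : ∀ x, IsLeech x → IsLeech (f x)
  dot : ∀ x y, IsLeech x → IsLeech y → ∑ i, f x i * f y i = ∑ i, x i * y i

theorem golayCode_dot {c d : LeechIndex → ZMod 2} (hc : c ∈ golayCode) (hd : d ∈ golayCode) :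
    ∑ i, c i * d i = 0 := by
  rw [exists_wordOf c] at hc ⊢
  rw [exists_wordOf d] at hd ⊢
  generalize (Finset.univ.filter fun i => c i = 1) = s at *
  generalize (Finset.univ.filter fun i => d i = 1) = t at *
  have h : ∀ i, wordOf s i * wordOf t i = if i ∈ s ∩ t then 1 else 0 := by
    intro i
    simp only [wordOf, Finset.mem_inter]
    by_cases hs : i ∈ s <;> by_cases ht : i ∈ t <;> simp [hs, ht]
  simp only [h, Finset.sum_boole, Finset.filter_univ_mem]
  exact (ZMod.natCast_eq_zero_iff _ 2).2 (IsGolay.even_inter hc hd).two_dvd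

theorem IsGolay.even_sum {O : Finset LeechIndex} (hO : IsGolay O) {y : LeechIndex → ℤ}
    (hy : (fun i => (y i : ZMod 2)) ∈ golayCode) : Even (∑ i ∈ O, y i) := by
  have h := golayCode_dot hO hy
  simp only [wordOf, ite_mul, one_mul, zero_mul, Finset.sum_ite_mem, Finset.univ_inter] at h
  rw [← Int.cast_sum] at h
  exact even_iff_two_dvd.2 ((ZMod.intCast_zmod_eq_zero_iff_dvd _ 2).1 h)

/-- Change of sign on the set `O`. -/
def signChange (O : Finset LeechIndex) (x : LeechIndex → ℤ) : LeechIndex → ℤ :=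
  fun i => if i ∈ O then -x i else x i

theorem sum_signChange (O : Finset LeechIndex) (x : LeechIndex → ℤ) :
    ∑ i, signChange O x i = ∑ i, x i - 2 * ∑ i ∈ O, x i := by
  have h : ∀ i, signChange O x i = x i - 2 * (if i ∈ O then x i else 0) := by
    intro i
    unfold signChange
    split_ifs <;> ring
  simp only [h, Finset.sum_sub_distrib, ← Finset.mul_sum, Finset.sum_ite_mem, Finset.univ_inter]

/-- Replacing `x i` by `-x i` subtracts `x i ≡ m` from `y i`, which modulo 2 adds a multiple of the
word of `O`. The coordinate sum changes by twice the sum over `O`, and that sum is divisible by 4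
since `|O|` is and `y` has even sum on `O`. -/
theorem IsGolay.isLeechIsometry {O : Finset LeechIndex} (hO : IsGolay O) :
    IsLeechIsometry (signChange O) := by
  constructor
  · rintro x ⟨m, y, hy, hs, hx⟩
    have hx' : ∑ i, x i ≡ 4 * m [ZMOD 8] := by simpa only [hx] using hs
    have hval : ∀ i, signChange O x i = m + 2 * (y i - if i ∈ O then x i else 0) := by
      intro i
      unfold signChange
      have := hx i
      split_ifs <;> linarith
    refine ⟨m, fun i => y i - if i ∈ O then x i else 0, ?_, ?_, hval⟩
    · have h : (fun i => ((y i - if i ∈ O then x i else 0 : ℤ) : ZMod 2)) =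
          (fun i => (y i : ZMod 2)) + (m : ZMod 2) • wordOf O := by
        funext i
        have h2 : (2 : ZMod 2) = 0 := rfl
        simp only [Pi.add_apply, Pi.smul_apply, wordOf, smul_eq_mul]
        split_ifs
        · rw [hx]
          push_cast
          rw [h2, zero_mul, add_zero, sub_eq_add_neg, ZMod.neg_eq_self_mod_two, mul_one]
        · push_cast; ring
      rw [h]
      exact golayCode.add_mem hy (golayCode.smul_mem _ hO)
    · simp only [← hval]
      rw [sum_signChange]
      have h4 : (4 : ℤ) ∣ ∑ i ∈ O, x i := by
        simp only [hx, Finset.sum_add_distrib, ← Finset.mul_sum, Finset.sum_const, nsmul_eq_mul]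
        obtain ⟨k, hk⟩ := (hO.even_sum hy).two_dvd
        obtain ⟨l, hl⟩ := hO.four_dvd
        rw [hk, hl]
        exact ⟨l * m + k, by push_cast; ring⟩
      obtain ⟨k, hk⟩ := h4
      rw [hk]
      unfold Int.ModEq at *
      omega
  · intro x y _ _
    refine Finset.sum_congr rfl fun i _ => ?_
    unfold signChange
    split_ifs <;> ring

/-- The sum of the coordinates of `x` over a tetrad. -/
def tetradSum (τ : LeechIndex → Fin 6) (x : LeechIndex → ℤ) (a : Fin 6) : ℤ :=
  ∑ i with τ i = a, x i

/-- Conway's map of a sextet: subtract from each coordinate half of the sum over its tetrad, then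
change the signs on the tetrad `0`. -/
def sextetMap (τ : LeechIndex → Fin 6) (x : LeechIndex → ℤ) : LeechIndex → ℤ :=
  fun i => (if τ i = 0 then -1 else 1) * (x i - tetradSum τ x (τ i) / 2)

theorem sum_tetradSum (τ : LeechIndex → Fin 6) (x : LeechIndex → ℤ) :
    ∑ a, tetradSum τ x a = ∑ i, x i :=
  Finset.sum_fiberwise _ _ _

theorem IsSextet.tetradSum_comp {τ : LeechIndex → Fin 6} (hτ : IsSextet τ) (k : Fin 6 → ℤ)
    (a : Fin 6) : tetradSum τ (fun i => k (τ i)) a = 4 * k a := by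
  have h : ∀ i ∈ Finset.univ.filter (fun i => τ i = a), k (τ i) = k a := by
    intro i hi
    rw [(Finset.mem_filter.1 hi).2]
  rw [tetradSum, Finset.sum_congr rfl h, Finset.sum_const, hτ.card_fiber]
  simp

theorem IsSextet.sum_comp {τ : LeechIndex → Fin 6} (hτ : IsSextet τ) (k : Fin 6 → ℤ) :
    ∑ i, k (τ i) = 4 * ∑ a, k a := by
  rw [← sum_tetradSum τ, Finset.mul_sum]
  exact Finset.sum_congr rfl fun a _ => hτ.tetradSum_comp k a

theorem IsSextet.two_dvd_tetradSum_sub {τ : LeechIndex → Fin 6} (hτ : IsSextet τ)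
    {y : LeechIndex → ℤ} (hy : (fun i => (y i : ZMod 2)) ∈ golayCode) (a b : Fin 6) :
    (2 : ℤ) ∣ tetradSum τ y a - tetradSum τ y b := by
  have h := golayCode_dot (hτ.isGolay a b) hy
  simp only [wordOf_symmDiff, Pi.add_apply, add_mul, Finset.sum_add_distrib] at h
  simp only [wordOf, ite_mul, one_mul, zero_mul, Finset.sum_ite_mem, Finset.univ_inter] at h
  rw [← Int.cast_sum, ← Int.cast_sum, ← Int.cast_add, ZMod.intCast_zmod_eq_zero_iff_dvd] at h
  change (2 : ℤ) ∣ tetradSum τ y a + tetradSum τ y b at h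
  omega

theorem IsSextet.tetradSum_affine {τ : LeechIndex → Fin 6} (hτ : IsSextet τ) {m : ℤ}
    {x y : LeechIndex → ℤ} (hx : ∀ i, x i = m + 2 * y i) (a : Fin 6) :
    tetradSum τ x a = 2 * (2 * m + tetradSum τ y a) := by
  simp only [tetradSum, hx, Finset.sum_add_distrib, ← Finset.mul_sum, Finset.sum_const,
    hτ.card_fiber, nsmul_eq_mul]
  push_cast
  ring

/-- Write the tetrad sums of `y` as `σ - 2 * k a`. The image is `-(m + σ) + 2 * z`, where modulo 2
`z` differs from `y` by `k` on the tetrads plus `m + σ` on tetrad `0`. The condition on the sum of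
`x` gives `∑ a, k a ≡ m + σ` modulo 2, so the sign change on tetrad `0` is what makes the correction
a Golay word. -/
theorem IsSextet.isLeech_sextetMap {τ : LeechIndex → Fin 6} (hτ : IsSextet τ)
    {x : LeechIndex → ℤ} (h : IsLeech x) : IsLeech (sextetMap τ x) := by
  obtain ⟨m, y, hy, hs, hx⟩ := h
  have hx' : ∑ i, x i = 24 * m + 2 * ∑ i, y i := by
    simp only [hx, Finset.sum_add_distrib, ← Finset.mul_sum, Finset.sum_const, Finset.card_univ,
      card_leechIndex, nsmul_eq_mul]
    norm_num
  simp only [← hx] at hs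
  rw [hx'] at hs
  choose k hk using fun a => hτ.two_dvd_tetradSum_sub hy 0 a
  set σ := tetradSum τ y 0 with hσ
  have hk0 : k 0 = 0 := by have := hk 0; omega
  have hK : 2 * ∑ a, k a = 6 * σ - ∑ i, y i := by
    rw [← sum_tetradSum τ y, Finset.mul_sum]
    rw [Finset.sum_congr rfl fun a _ => (hk a).symm, Finset.sum_sub_distrib]
    simp
  set z : LeechIndex → ℤ := fun i => y i + k (τ i) + if τ i = 0 then m + σ - 2 * y i else 0
    with hz
  have hzsum : ∑ i, z i = ∑ i, y i + 4 * ∑ a, k a + (4 * (m + σ) - 2 * σ) := by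
    have h0 : ∑ i, (if τ i = 0 then m + σ - 2 * y i else 0) = 4 * (m + σ) - 2 * σ := by
      rw [← Finset.sum_filter, Finset.sum_sub_distrib, ← Finset.mul_sum, Finset.sum_const,
        hτ.card_fiber]
      simp [hσ, tetradSum]
    simp only [hz, Finset.sum_add_distrib, hτ.sum_comp, h0]
  have hval : ∀ i, sextetMap τ x i = -(m + σ) + 2 * z i := by
    intro i
    have h1 := hk (τ i)
    simp only [sextetMap, hτ.tetradSum_affine hx, hz, hx]
    rw [Int.mul_ediv_cancel_left _ (by norm_num)]
    by_cases h : τ i = 0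
    · rw [h, hk0]
      simp only [if_true, ← hσ]
      ring
    · simp only [h, if_false]
      linarith
  refine ⟨-(m + σ), z, ?_, ?_, hval⟩
  · have h : (fun i => (z i : ZMod 2)) = (fun i => (y i : ZMod 2)) +
        fun i => ((k (τ i) + if τ i = 0 then m + σ else 0 : ℤ) : ZMod 2) := by
      funext i
      have h2 : (2 : ZMod 2) = 0 := rfl
      simp only [Pi.add_apply, hz]
      split_ifs
      · push_cast
        rw [h2]
        ring
      · push_cast
        ring
    rw [h]
    refine golayCode.add_mem hy
      (hτ.comp_mem_golayCode (fun a => k a + if a = 0 then m + σ else 0) ?_)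
    rw [Finset.sum_add_distrib, Finset.sum_ite_eq' Finset.univ (0 : Fin 6)]
    simp only [Finset.mem_univ, if_true]
    unfold Int.ModEq at hs
    rw [Int.even_iff]
    omega
  · simp only [Finset.sum_add_distrib, ← Finset.mul_sum, Finset.sum_const, Finset.card_univ,
      card_leechIndex, nsmul_eq_mul, hzsum]
    unfold Int.ModEq at *
    push_cast
    omega

/-- Up to sign, the map is on each tetrad the reflection in its all-ones vector. Tetrad sums of
lattice vectors are even, so the integer division is exact. -/
theorem IsSextet.isLeechIsometry {τ : LeechIndex → Fin 6} (hτ : IsSextet τ) :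
    IsLeechIsometry (sextetMap τ) := by
  refine ⟨fun x hx => hτ.isLeech_sextetMap hx, ?_⟩
  rintro x y ⟨m, u, -, -, hx⟩ ⟨n, v, -, -, hy⟩
  rw [← Finset.sum_fiberwise Finset.univ τ,
    ← Finset.sum_fiberwise Finset.univ τ fun i => x i * y i]
  refine Finset.sum_congr rfl fun a _ => ?_
  set s := 2 * m + tetradSum τ u a with hs
  set t := 2 * n + tetradSum τ v a with ht
  have hsx := hτ.tetradSum_affine hx a
  have hty := hτ.tetradSum_affine hy a
  rw [← hs] at hsx
  rw [← ht] at hty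
  have h : ∀ i ∈ Finset.univ.filter (fun i => τ i = a), sextetMap τ x i * sextetMap τ y i =
      x i * y i - (t * x i + s * y i - s * t) := by
    intro i hi
    have hi := (Finset.mem_filter.1 hi).2
    simp only [sextetMap, hi, hsx, hty]
    rw [Int.mul_ediv_cancel_left _ (by norm_num), Int.mul_ediv_cancel_left _ (by norm_num)]
    split_ifs <;> ring
  rw [Finset.sum_congr rfl h, Finset.sum_sub_distrib, Finset.sum_sub_distrib,
    Finset.sum_add_distrib, ← Finset.mul_sum, ← Finset.mul_sum, Finset.sum_const, hτ.card_fiber]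
  change _ - (t * tetradSum τ x a + s * tetradSum τ y a - _) = _
  rw [hsx, hty]
  simp only [nsmul_eq_mul]
  push_cast
  ring

/-! ### The shell, its group, and transitivity. -/

/-- The vectors of norm 32 of the Leech lattice in integral coordinates. -/
def leechShell : Set (LeechIndex → ℤ) := {x | IsLeech x ∧ ∑ i, x i * x i = 32}

/-- The permutations of the shell that preserve all inner products. -/
def shellGroup : Subgroup (Equiv.Perm leechShell) where
  carrier := {g | ∀ x y : leechShell, ∑ i, (g x).1 i * (g y).1 i = ∑ i, x.1 i * y.1 i}
  one_mem' := fun _ _ => rfl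
  mul_mem' := fun {g h} hg hh x y => (hg (h x) (h y)).trans (hh x y)
  inv_mem' := fun {g} hg x y => by
    have h := hg (g⁻¹ x) (g⁻¹ y)
    simp only [Equiv.Perm.inv_def, Equiv.apply_symm_apply] at h
    exact h.symm

theorem abs_le_of_sum_mul_self_le {ι : Type*} [Fintype ι] {x : ι → ℤ} {n : ℤ}
    (h : ∑ i, x i * x i ≤ n) (i : ι) : |x i| ≤ n := by
  have h1 : x i * x i ≤ ∑ i, x i * x i :=
    Finset.single_le_sum (f := fun i => x i * x i) (fun j _ => mul_self_nonneg _)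
      (Finset.mem_univ i)
  rw [← abs_mul_abs_self] at h1
  nlinarith [abs_nonneg (x i), mul_self_nonneg (|x i| - 1)]

theorem leechShell_finite : leechShell.Finite := by
  refine (Set.finite_Icc (fun _ => (-32 : ℤ)) fun _ => 32).subset fun x hx => ?_
  exact ⟨fun i => (abs_le.1 (abs_le_of_sum_mul_self_le hx.2.le i)).1,
    fun i => (abs_le.1 (abs_le_of_sum_mul_self_le hx.2.le i)).2⟩

instance : Finite leechShell := leechShell_finite

/-- The equality case of Cauchy–Schwarz: `x - y` has norm 0. It stands in for linearity, which
permutations of the shell are not assumed to have. -/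
theorem eq_of_dot_eq {ι : Type*} [Fintype ι] {x y : ι → ℤ} {n : ℤ} (hx : ∑ i, x i * x i = n)
    (hy : ∑ i, y i * y i = n) (hxy : ∑ i, x i * y i = n) : x = y := by
  have h : ∑ i, (x i - y i) * (x i - y i) = 0 := by
    have : ∀ i, (x i - y i) * (x i - y i) = x i * x i - 2 * (x i * y i) + y i * y i :=
      fun i => by ring
    simp only [this, Finset.sum_add_distrib, Finset.sum_sub_distrib, ← Finset.mul_sum, hx, hy, hxy]
    ring
  rw [Finset.sum_eq_zero_iff_of_nonneg fun i _ => mul_self_nonneg _] at h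
  funext i
  have := mul_self_eq_zero.1 (h i (Finset.mem_univ i))
  omega

theorem IsLeechIsometry.mem_leechShell {f : (LeechIndex → ℤ) → LeechIndex → ℤ}
    (hf : IsLeechIsometry f) {x : LeechIndex → ℤ} (hx : x ∈ leechShell) : f x ∈ leechShell :=
  ⟨hf.isLeech x hx.1, (hf.dot x x hx.1 hx.1).trans hx.2⟩

/-- Equivalence of vectors under the group of the shell. -/
def ShellRel (x y : LeechIndex → ℤ) : Prop :=
  ∃ (hx : x ∈ leechShell) (hy : y ∈ leechShell), ∃ g ∈ shellGroup, g ⟨x, hx⟩ = ⟨y, hy⟩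

theorem ShellRel.refl {x : LeechIndex → ℤ} (hx : x ∈ leechShell) : ShellRel x x :=
  ⟨hx, hx, 1, shellGroup.one_mem, rfl⟩

theorem ShellRel.symm {x y : LeechIndex → ℤ} : ShellRel x y → ShellRel y x := by
  rintro ⟨hx, hy, g, hg, h⟩
  exact ⟨hy, hx, g⁻¹, shellGroup.inv_mem hg, by rw [← h, Equiv.Perm.inv_def, Equiv.symm_apply_apply]⟩

theorem ShellRel.trans {x y z : LeechIndex → ℤ} : ShellRel x y → ShellRel y z → ShellRel x z := by
  rintro ⟨hx, hy, g, hg, h⟩ ⟨_, hz, g', hg', h'⟩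
  exact ⟨hx, hz, g' * g, shellGroup.mul_mem hg' hg, by rw [Equiv.Perm.mul_apply, h, h']⟩

theorem ShellRel.mem_right {x y : LeechIndex → ℤ} (h : ShellRel x y) : y ∈ leechShell := h.2.1

/-- Preserving inner products makes `f` injective on the shell, and the shell is finite, so `f`
restricts to a permutation. -/
theorem IsLeechIsometry.shellRel {f : (LeechIndex → ℤ) → LeechIndex → ℤ}
    (hf : IsLeechIsometry f) {x : LeechIndex → ℤ} (hx : x ∈ leechShell) : ShellRel x (f x) := by
  set φ : leechShell → leechShell := fun x => ⟨f x.1, hf.mem_leechShell x.2⟩ with hφ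
  have hinj : Function.Injective φ := by
    intro x y h
    have h : f x.1 = f y.1 := congrArg Subtype.val h
    refine Subtype.ext (eq_of_dot_eq x.2.2 y.2.2 ?_)
    rw [← hf.dot x y x.2.1 y.2.1, h, hf.dot y y y.2.1 y.2.1]
    exact y.2.2
  refine ⟨hx, hf.mem_leechShell hx, Equiv.ofBijective φ (Finite.injective_iff_bijective.1 hinj),
    fun x y => hf.dot x y x.2.1 y.2.1, rfl⟩

/-- For `m = 2 * k` the constant `k` is absorbed into `y`, as the all-ones word is in the code. -/
theorem IsLeech.odd_or_even {x : LeechIndex → ℤ} (hx : IsLeech x) :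
    (∀ i, Odd (x i)) ∨ ∃ y : LeechIndex → ℤ, (fun i => (y i : ZMod 2)) ∈ golayCode ∧
      4 ∣ ∑ i, y i ∧ ∀ i, x i = 2 * y i := by
  obtain ⟨m, y, hy, hs, hx⟩ := hx
  rcases Int.even_or_odd' m with ⟨k, rfl | rfl⟩
  · refine Or.inr ⟨fun i => y i + k, ?_, ?_, fun i => by rw [hx]; ring⟩
    · have h : (fun i => ((y i + k : ℤ) : ZMod 2)) =
          (fun i => (y i : ZMod 2)) + (k : ZMod 2) • wordOf Finset.univ := by
        funext i
        simp [wordOf]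
      rw [h]
      exact golayCode.add_mem hy (golayCode.smul_mem _ isGolay_univ)
    · have h : ∑ i, (2 * k + 2 * y i) = 2 * ∑ i, (y i + k) := by
        rw [Finset.mul_sum]
        exact Finset.sum_congr rfl fun i _ => by ring
      rw [h] at hs
      unfold Int.ModEq at hs
      change 4 ∣ ∑ i, (y i + k)
      omega
  · exact Or.inl fun i => ⟨k + y i, by rw [hx]; ring⟩

theorem two_dvd_sum_sub_card {ι : Type*} {T : Finset ι} {y : ι → ℤ} (h : ∀ i ∈ T, Odd (y i)) :
    2 ∣ ∑ i ∈ T, y i - T.card := by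
  have h1 : ∑ i ∈ T, y i - T.card = ∑ i ∈ T, (y i - 1) := by simp [Finset.sum_sub_distrib]
  rw [h1]
  exact Finset.dvd_sum fun i hi => (Odd.sub_odd (h i hi) odd_one).two_dvd

theorem sum_signChange_subset (O T : Finset LeechIndex) (x : LeechIndex → ℤ) :
    ∑ i ∈ T, signChange O x i = ∑ i ∈ T, x i - 2 * ∑ i ∈ T ∩ O, x i := by
  have h : ∀ i, signChange O x i = x i - 2 * (if i ∈ O then x i else 0) := by
    intro i
    unfold signChange
    split_ifs <;> ring
  simp only [h, Finset.sum_sub_distrib, ← Finset.mul_sum, Finset.sum_ite_mem]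

/-- Four odd numbers have an even sum. If it is 0 modulo 4, a sign change at an odd number of points
of `T` alters it by twice an odd number. The factor `c` is 1 for odd vectors and 2 for even ones. -/
theorem exists_shellRel_sum_mod_four {T : Finset LeechIndex} (hT : T.card = 4)
    {x : LeechIndex → ℤ} (hx : x ∈ leechShell) (c : ℤ) (y : LeechIndex → ℤ)
    (hxy : ∀ i, x i = c * y i) (hy : ∀ i ∈ T, Odd (y i)) :
    ∃ (x' y' : LeechIndex → ℤ), ShellRel x x' ∧ (∀ i, x' i = c * y' i) ∧
      (∀ i, y' i = y i ∨ y' i = -y i) ∧ (∑ i ∈ T, y' i) % 4 = 2 := by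
  have h1 := two_dvd_sum_sub_card hy
  rw [hT] at h1
  by_cases h : (∑ i ∈ T, y i) % 4 = 2
  · exact ⟨x, y, ShellRel.refl hx, hxy, fun i => Or.inl rfl, h⟩
  · obtain ⟨O, hO, hodd⟩ := exists_golay_odd_inter hT
    have h2 := two_dvd_sum_sub_card (T := T ∩ O) fun i hi => hy i (Finset.mem_inter.1 hi).1
    refine ⟨signChange O x, signChange O y, hO.isLeechIsometry.shellRel hx, fun i => ?_,
      fun i => ?_, ?_⟩
    · unfold signChange
      split_ifs <;> rw [hxy]
      ring
    · unfold signChange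
      split_ifs
      · exact Or.inr rfl
      · exact Or.inl rfl
    · rw [sum_signChange_subset]
      obtain ⟨k, hk⟩ := hodd
      rw [hk] at h2
      omega

/-- If the sum over a tetrad of odd coordinates is 2 modulo 4, the sextet map subtracts an odd
number there and creates an even coordinate; then all coordinates are even. -/
theorem exists_shellRel_even {x : LeechIndex → ℤ} (hx : x ∈ leechShell) :
    ∃ x' y : LeechIndex → ℤ, ShellRel x x' ∧ (fun i => (y i : ZMod 2)) ∈ golayCode ∧
      4 ∣ ∑ i, y i ∧ ∀ i, x' i = 2 * y i := by
  rcases hx.1.odd_or_even with hodd | ⟨y, h⟩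
  · obtain ⟨T, -, hT⟩ := Finset.exists_subset_card_eq
      (s := (Finset.univ : Finset LeechIndex)) (n := 4)
      (by rw [Finset.card_univ, card_leechIndex]; norm_num)
    obtain ⟨τ, hτ, a, ha⟩ := exists_isSextet hT
    obtain ⟨x₁, y₁, hrel, hxy, hy₁, hmod⟩ :=
      exists_shellRel_sum_mod_four hT hx 1 x (by simp) fun i _ => hodd i
    have hx₁ : ∀ i, x₁ i = y₁ i := fun i => by rw [hxy, one_mul]
    obtain rfl : x₁ = y₁ := funext hx₁
    have hrel₂ := hrel.trans (hτ.isLeechIsometry.shellRel hrel.mem_right)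
    rcases hrel₂.mem_right.1.odd_or_even with hodd₂ | ⟨y, h⟩
    · exfalso
      obtain ⟨t, ht⟩ := Finset.card_pos.1 (by omega : 0 < T.card)
      have hta : τ t = a := by
        rw [← ha] at ht
        exact (Finset.mem_filter.1 ht).2
      have h1 : tetradSum τ x₁ a = ∑ i ∈ T, x₁ i := by rw [tetradSum, ha]
      have h2 := hodd₂ t
      have h3 : Odd (x₁ t) := by
        rcases hy₁ t with h | h <;> rw [h]
        · exact hodd t
        · exact (hodd t).neg
      simp only [sextetMap, hta, h1] at h2
      rw [Int.odd_mul] at h2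
      rw [Int.odd_iff] at h3
      have := Int.odd_iff.1 h2.2
      omega
    · exact ⟨_, y, hrel₂, h⟩
  · exact ⟨x, y, ShellRel.refl hx, h⟩

theorem exists_golay_odd_support {y : LeechIndex → ℤ}
    (hy : (fun i => (y i : ZMod 2)) ∈ golayCode) : ∃ s, IsGolay s ∧ ∀ i, i ∈ s ↔ Odd (y i) := by
  refine ⟨Finset.univ.filter fun i => (y i : ZMod 2) = 1, ?_, fun i => ?_⟩
  · rw [exists_wordOf fun i => (y i : ZMod 2)] at hy
    exact hy
  · simp only [Finset.mem_filter, Finset.mem_univ, true_and]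
    exact ZMod.intCast_eq_one_iff_odd

/-- An even vector of norm 32 that is not divisible by 4 is supported on an octad. -/
theorem octad_of_odd_support {y : LeechIndex → ℤ} (hn : ∑ i, y i * y i = 8)
    {s : Finset LeechIndex} (hs : IsGolay s) (hne : s.Nonempty) (hodd : ∀ i, i ∈ s ↔ Odd (y i)) :
    s ∈ octads ∧ ∀ i, i ∉ s → y i = 0 := by
  have h8 := hs.eight_le hne
  have h1 : ∀ i ∈ s, 1 ≤ y i * y i := by
    intro i hi
    have : y i ≠ 0 := fun h => by
      have := (hodd i).1 hi
      rw [h] at this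
      exact absurd this (by decide)
    have := mul_self_pos.2 this
    omega
  have h2 : (s.card : ℤ) ≤ ∑ i ∈ s, y i * y i := by
    have := Finset.sum_le_sum h1
    simpa using this
  have h3 := Finset.sum_add_sum_compl s fun i => y i * y i
  have h4 : 0 ≤ ∑ i ∈ sᶜ, y i * y i := Finset.sum_nonneg fun i _ => mul_self_nonneg _
  have h5 : ∑ i ∈ sᶜ, y i * y i = 0 := by omega
  rw [Finset.sum_eq_zero_iff_of_nonneg fun i _ => mul_self_nonneg _] at h5
  refine ⟨mem_octads.2 ⟨hs, by omega⟩, fun i hi => ?_⟩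
  exact mul_self_eq_zero.1 (h5 i (Finset.mem_compl.2 hi))

/-- Up to sign the image is `2 * y i` minus the tetrad sum of `y`. The octad `s` is the union of
tetrad `a` and one other; both have sum 2 modulo 4, as the total is divisible by 4, and `y i` is odd
there. Elsewhere everything vanishes. -/
theorem IsSextet.four_dvd_sextetMap {τ : LeechIndex → Fin 6} (hτ : IsSextet τ) {a : Fin 6}
    {x y : LeechIndex → ℤ} (hxy : ∀ i, x i = 2 * y i) (hsum : 4 ∣ ∑ i, y i)
    {s : Finset LeechIndex} (hs : s ∈ octads) (hodd : ∀ i, i ∈ s → Odd (y i))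
    (hzero : ∀ i, i ∉ s → y i = 0) (hsub : (Finset.univ.filter fun i => τ i = a) ⊆ s)
    (hmod : tetradSum τ y a % 4 = 2) (i : LeechIndex) : 4 ∣ sextetMap τ x i := by
  have hx : ∀ b, tetradSum τ x b = 2 * tetradSum τ y b := by
    intro b
    rw [tetradSum, tetradSum, Finset.mul_sum]
    exact Finset.sum_congr rfl fun i _ => hxy i
  have hblock : ∀ j ∈ s, τ j ≠ a →
      (Finset.univ.filter fun i => τ i = a) ∪ (Finset.univ.filter fun i => τ i = τ j) = s := by
    intro j hj hja
    have hdisj : Disjoint (Finset.univ.filter fun i => τ i = a)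
        (Finset.univ.filter fun i => τ i = τ j) := by
      rw [Finset.disjoint_filter]
      exact fun i _ h1 h2 => hja (h2.symm.trans h1)
    have hcard := Finset.card_union_of_disjoint hdisj
    rw [hτ.card_fiber, hτ.card_fiber] at hcard
    have hG := hτ.isGolay a (τ j)
    rw [hdisj.symmDiff_eq_sup] at hG
    refine octads_eq_of_card_inter (mem_octads.2 ⟨hG, hcard⟩) hs ?_
    have hnot : j ∉ Finset.univ.filter fun i => τ i = a := by simpa using hja
    rw [show 5 = (insert j (Finset.univ.filter fun i => τ i = a)).card by
      rw [Finset.card_insert_of_notMem hnot, hτ.card_fiber]]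
    refine Finset.card_le_card (Finset.subset_inter ?_ (Finset.insert_subset hj hsub))
    exact Finset.insert_subset (Finset.mem_union_right _ (by simp)) Finset.subset_union_left
  have hmain : 4 ∣ 2 * y i - tetradSum τ y (τ i) := by
    by_cases hia : τ i = a
    · have := hodd i (hsub (by simpa using hia))
      rw [Int.odd_iff] at this
      rw [hia]
      omega
    by_cases hi : i ∈ s
    · have hdisj : Disjoint (Finset.univ.filter fun j => τ j = a)
          (Finset.univ.filter fun j => τ j = τ i) := by
        rw [Finset.disjoint_filter]
        exact fun j _ h1 h2 => hia (h2.symm.trans h1)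
      have h1 := Finset.sum_union hdisj (f := y)
      rw [hblock i hi hia, Finset.sum_subset (Finset.subset_univ s) fun j _ hj => hzero j hj] at h1
      change _ = tetradSum τ y a + tetradSum τ y (τ i) at h1
      have := hodd i hi
      rw [Int.odd_iff] at this
      omega
    · have h0 : tetradSum τ y (τ i) = 0 := by
        refine Finset.sum_eq_zero fun j hj => hzero j fun hjs => hi ?_
        have hj := (Finset.mem_filter.1 hj).2
        rw [← hblock j hjs (hj ▸ hia)]
        exact Finset.mem_union_right _ (by simp [hj])
      rw [h0, hzero i hi]
      norm_num
  unfold sextetMap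
  rw [hx, Int.mul_ediv_cancel_left _ (by norm_num), hxy]
  exact Dvd.dvd.mul_left hmain _

theorem exists_shellRel_four_dvd {x : LeechIndex → ℤ} (hx : x ∈ leechShell) :
    ∃ x', ShellRel x x' ∧ ∀ i, 4 ∣ x' i := by
  obtain ⟨x₁, y, hrel, hy, -, hxy⟩ := exists_shellRel_even hx
  have norm : ∀ {x y : LeechIndex → ℤ}, x ∈ leechShell → (∀ i, x i = 2 * y i) →
      ∑ i, y i * y i = 8 := by
    intro x y hx hxy
    have h1 := hx.2
    have h2 : ∀ i, x i * x i = 4 * (y i * y i) := fun i => by rw [hxy]; ring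
    simp only [h2, ← Finset.mul_sum] at h1
    omega
  obtain ⟨s, hs, hodd⟩ := exists_golay_odd_support hy
  rcases s.eq_empty_or_nonempty with rfl | hne
  · refine ⟨x₁, hrel, fun i => ?_⟩
    have h := (hodd i).not.1 (by simp)
    rw [Int.not_odd_iff_even, Int.even_iff] at h
    rw [hxy]
    omega
  obtain ⟨hoct, -⟩ := octad_of_odd_support (norm hrel.mem_right hxy) hs hne hodd
  obtain ⟨T, hTs, hT⟩ := Finset.exists_subset_card_eq (s := s) (n := 4)
    (by rw [(mem_octads.1 hoct).2]; norm_num)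
  obtain ⟨x₂, y₂, hrel₂, hxy₂, hy₂, hmod⟩ := exists_shellRel_sum_mod_four hT hrel.mem_right 2 y hxy
    fun i hi => (hodd i).1 (hTs hi)
  have hodd₂ : ∀ i, i ∈ s ↔ Odd (y₂ i) := by
    intro i
    rw [hodd]
    rcases hy₂ i with h | h <;> rw [h]
    exact odd_neg.symm
  obtain ⟨-, hzero⟩ := octad_of_odd_support (norm hrel₂.mem_right hxy₂) hs hne hodd₂
  have hsum : 4 ∣ ∑ i, y₂ i := by
    rcases hrel₂.mem_right.1.odd_or_even with h | ⟨u, -, hu, hxu⟩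
    · have := h none
      rw [hxy₂, Int.odd_iff] at this
      omega
    · have : u = y₂ := funext fun i => by
        have h1 := hxu i
        have h2 := hxy₂ i
        omega
      rwa [← this]
  obtain ⟨τ, hτ, a, ha⟩ := exists_isSextet hT
  refine ⟨_, (hrel.trans hrel₂).trans (hτ.isLeechIsometry.shellRel hrel₂.mem_right),
    hτ.four_dvd_sextetMap (a := a) hxy₂ hsum hoct (fun i => (hodd₂ i).1) hzero (ha ▸ hTs) ?_⟩
  rwa [tetradSum, ha]

/-- The vector with coordinates 4 on `P` and 0 elsewhere. -/
def fourVector (P : Finset LeechIndex) : LeechIndex → ℤ := fun k => if k ∈ P then 4 else 0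

/-- A Golay word containing exactly one of `i`, `j` corrects a single wrong sign; the all-ones word
corrects two. -/
theorem shellRel_fourVector {x : LeechIndex → ℤ} (hx : x ∈ leechShell) {i j : LeechIndex}
    (hij : i ≠ j) (hi : x i = 4 ∨ x i = -4) (hj : x j = 4 ∨ x j = -4)
    (h0 : ∀ k, k ≠ i → k ≠ j → x k = 0) : ShellRel x (fourVector {i, j}) := by
  have key : ∀ O, IsGolay O → signChange O x i = 4 → signChange O x j = 4 →
      ShellRel x (fourVector {i, j}) := by
    intro O hO h1 h2
    have h : signChange O x = fourVector {i, j} := by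
      funext k
      by_cases hki : k = i
      · simpa [hki, fourVector] using h1
      by_cases hkj : k = j
      · simpa [hkj, fourVector] using h2
      simp [signChange, fourVector, hki, hkj, h0 k hki hkj]
    rw [← h]
    exact hO.isLeechIsometry.shellRel hx
  rcases hi with hi | hi <;> rcases hj with hj | hj
  · exact key ∅ isGolay_empty (by simp [signChange, hi]) (by simp [signChange, hj])
  · obtain ⟨O, hO, h1, h2⟩ := exists_golay_mem_notMem hij.symm
    exact key O hO (by simp [signChange, h2, hi]) (by simp [signChange, h1, hj])
  · obtain ⟨O, hO, h1, h2⟩ := exists_golay_mem_notMem hij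
    exact key O hO (by simp [signChange, h1, hi]) (by simp [signChange, h2, hj])
  · exact key _ isGolay_univ (by simp [signChange, hi]) (by simp [signChange, hj])

/-- Once divided by 4, the vector has norm 2, hence exactly two nonzero entries, each `±1`. -/
theorem exists_shellRel_fourVector {x : LeechIndex → ℤ} (hx : x ∈ leechShell) :
    ∃ P, P.card = 2 ∧ ShellRel x (fourVector P) := by
  obtain ⟨x₁, hrel, hdvd⟩ := exists_shellRel_four_dvd hx
  choose z hz using hdvd
  have hn : ∑ i, z i * z i = 2 := by
    have h1 := hrel.mem_right.2
    have h2 : ∀ i, x₁ i * x₁ i = 16 * (z i * z i) := fun i => by rw [hz]; ring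
    simp only [h2, ← Finset.mul_sum] at h1
    omega
  set P := Finset.univ.filter fun i => z i ≠ 0 with hP
  have hmem : ∀ i, i ∈ P ↔ z i ≠ 0 := by simp [hP]
  have hone : ∀ i ∈ P, z i = 1 ∨ z i = -1 := by
    intro i hi
    have h1 := abs_le_of_sum_mul_self_le hn.le i
    have h2 : z i * z i ≤ ∑ i, z i * z i :=
      Finset.single_le_sum (f := fun i => z i * z i) (fun j _ => mul_self_nonneg _)
        (Finset.mem_univ i)
    rw [hmem] at hi
    rw [abs_le] at h1
    rw [hn] at h2
    have : z i ≤ 1 := by nlinarith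
    have : -1 ≤ z i := by nlinarith
    omega
  have hsum : ∑ i, z i * z i = P.card := by
    rw [← Finset.sum_subset (Finset.subset_univ P) fun i _ hi => by
      rw [hmem, not_not] at hi
      rw [hi, mul_zero]]
    rw [Finset.sum_congr rfl (g := fun _ => 1) fun i hi => by
      rcases hone i hi with h | h <;> rw [h] <;> norm_num]
    simp
  have hcard : P.card = 2 := by omega
  refine ⟨P, hcard, hrel.trans ?_⟩
  obtain ⟨i, j, hij, h⟩ := Finset.card_eq_two.1 hcard
  have hi := hone i (by simp [h])
  have hj := hone j (by simp [h])
  rw [h]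
  refine shellRel_fourVector hrel.mem_right hij (by rw [hz]; omega) (by rw [hz]; omega) ?_
  intro k hki hkj
  have : k ∉ P := by simp [h, hki, hkj]
  rw [hmem, not_not] at this
  rw [hz, this, mul_zero]

/-- In the sextet of the tetrad `P ∪ Q` the only nonzero tetrad sum is 8. Subtracting 4 on that
tetrad clears `P` and puts `-4` on `Q`, up to sign. -/
theorem shellRel_fourVector_of_disjoint {P Q : Finset LeechIndex} (hP : P.card = 2)
    (hQ : Q.card = 2) (hPQ : Disjoint P Q) (hmem : fourVector P ∈ leechShell) :
    ShellRel (fourVector P) (fourVector Q) := by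
  obtain ⟨τ, hτ, a, ha⟩ := exists_isSextet (T := P ∪ Q)
    (by rw [Finset.card_union_of_disjoint hPQ, hP, hQ])
  have hrel := hτ.isLeechIsometry.shellRel hmem
  refine hrel.trans ?_
  have hmemT : ∀ k, τ k = a ↔ k ∈ P ∪ Q := by
    intro k
    rw [← ha]
    simp
  have hsum : ∀ b, tetradSum τ (fourVector P) b = if b = a then 8 else 0 := by
    intro b
    simp only [tetradSum, fourVector, Finset.sum_ite_mem]
    split_ifs with h
    · rw [h, ha, Finset.inter_eq_right.2 Finset.subset_union_left, Finset.sum_const, hP]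
      rfl
    · rw [Finset.sum_const, Finset.card_eq_zero.2, zero_smul]
      ext k
      simp only [Finset.mem_inter, Finset.mem_filter, Finset.mem_univ, true_and,
        Finset.notMem_empty, iff_false, not_and]
      intro hk hkP
      exact h (hk.symm.trans ((hmemT k).2 (Finset.mem_union_left _ hkP)))
  have hval : ∀ k ∈ Q, sextetMap τ (fourVector P) k = 4 ∨ sextetMap τ (fourVector P) k = -4 := by
    intro k hk
    have hkP : k ∉ P := Finset.disjoint_right.1 hPQ hk
    simp only [sextetMap, hsum, (hmemT k).2 (Finset.mem_union_right _ hk), fourVector, hkP, if_true,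
      if_false]
    split_ifs <;> norm_num
  have hval0 : ∀ k ∉ Q, sextetMap τ (fourVector P) k = 0 := by
    intro k hk
    by_cases hkP : k ∈ P
    · simp [sextetMap, hsum, (hmemT k).2 (Finset.mem_union_left _ hkP), fourVector, hkP]
    · have : τ k ≠ a := fun h => by
        rcases Finset.mem_union.1 ((hmemT k).1 h) with h | h
        · exact hkP h
        · exact hk h
      simp [sextetMap, hsum, this, fourVector, hkP]
  obtain ⟨i, j, hij, rfl⟩ := Finset.card_eq_two.1 hQ
  exact shellRel_fourVector hrel.mem_right hij (hval i (by simp)) (hval j (by simp))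
    fun k hki hkj => hval0 k (by simp [hki, hkj])

/-- The group of the shell acts transitively. -/
theorem shellRel_of_mem {x y : LeechIndex → ℤ} (hx : x ∈ leechShell) (hy : y ∈ leechShell) :
    ShellRel x y := by
  obtain ⟨P, hP, hxP⟩ := exists_shellRel_fourVector hx
  obtain ⟨Q, hQ, hyQ⟩ := exists_shellRel_fourVector hy
  have hcard := Finset.card_union_le P Q
  -- `P` and `Q` may overlap, so the path goes through a pair `R` disjoint from both.
  obtain ⟨R, hR, hR2⟩ := Finset.exists_subset_card_eq (s := (P ∪ Q)ᶜ) (n := 2) (by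
    rw [Finset.card_compl, card_leechIndex]
    omega)
  have hPQR : Disjoint (P ∪ Q) R := Finset.disjoint_right.2 fun i hi => Finset.mem_compl.1 (hR hi)
  have hPR : Disjoint P R :=
    Finset.disjoint_of_subset_left Finset.subset_union_left hPQR
  have hQR : Disjoint Q R :=
    Finset.disjoint_of_subset_left Finset.subset_union_right hPQR
  exact (hxP.trans (shellRel_fourVector_of_disjoint hP hR2 hPR hxP.mem_right)).trans
    (hyQ.trans (shellRel_fourVector_of_disjoint hQ hR2 hQR hyQ.mem_right)).symm

/-! ### Counting the shell from below. -/

/-- The vector with coordinates `-c` on `A`, `c` on the rest of `P`, and 0 elsewhere. -/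
def signedVector (c : ℤ) (P A : Finset LeechIndex) : LeechIndex → ℤ :=
  signChange A fun i => if i ∈ P then c else 0

theorem signedVector_apply (c : ℤ) (P A : Finset LeechIndex) (i : LeechIndex) :
    signedVector c P A i =
      if i ∈ A then -(if i ∈ P then c else 0) else if i ∈ P then c else 0 := rfl

theorem sum_signedVector (c : ℤ) {P A : Finset LeechIndex} (hA : A ⊆ P) :
    ∑ i, signedVector c P A i = c * P.card - 2 * c * A.card := by
  rw [signedVector, sum_signChange, Finset.sum_ite_mem, Finset.sum_ite_mem, Finset.univ_inter,
    Finset.inter_eq_left.2 hA, Finset.sum_const, Finset.sum_const, nsmul_eq_mul, nsmul_eq_mul]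
  ring

theorem sum_signedVector_mul_self (c : ℤ) (P A : Finset LeechIndex) :
    ∑ i, signedVector c P A i * signedVector c P A i = c * c * P.card := by
  have h : ∀ i, signedVector c P A i * signedVector c P A i = if i ∈ P then c * c else 0 := by
    intro i
    simp only [signedVector_apply]
    split_ifs <;> ring
  simp only [h, Finset.sum_ite_mem, Finset.univ_inter, Finset.sum_const, nsmul_eq_mul]
  ring

theorem signedVector_ne_zero_iff {c : ℤ} (hc : 0 < c) (P A : Finset LeechIndex) (i : LeechIndex) :
    signedVector c P A i ≠ 0 ↔ i ∈ P := by
  simp only [signedVector_apply]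
  by_cases h : i ∈ P <;> by_cases h' : i ∈ A <;> simp [h, h', hc.ne']

theorem signedVector_neg_iff {c : ℤ} (hc : 0 < c) {P A : Finset LeechIndex} (hA : A ⊆ P)
    (i : LeechIndex) : signedVector c P A i < 0 ↔ i ∈ A := by
  simp only [signedVector_apply]
  by_cases h1 : i ∈ A
  · simp [h1, hA h1, hc]
  · by_cases h2 : i ∈ P <;> simp [h1, h2, hc.le]

theorem signedVector_injOn {c : ℤ} (hc : 0 < c) : Set.InjOn
    (fun p : (_ : Finset LeechIndex) × Finset LeechIndex => signedVector c p.1 p.2)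
    {p | p.2 ⊆ p.1} := by
  rintro ⟨P, A⟩ hA ⟨Q, B⟩ hB h
  have h : signedVector c P A = signedVector c Q B := h
  have hPQ : P = Q := Finset.ext fun i => by
    rw [← signedVector_ne_zero_iff hc P A, ← signedVector_ne_zero_iff hc Q B, h]
  have hAB : A = B := Finset.ext fun i => by
    rw [← signedVector_neg_iff hc hA, ← signedVector_neg_iff hc hB]
    change signedVector c P A i < 0 ↔ signedVector c Q B i < 0
    rw [h]
  rw [hPQ, hAB]

/-- The positions and signs of the minimal vectors of shape `(±4², 0²²)`. -/
@[irreducible]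
def pairSigns : Finset ((_ : Finset LeechIndex) × Finset LeechIndex) :=
  (Finset.powersetCard 2 Finset.univ).sigma Finset.powerset

/-- The positions and signs of the minimal vectors of shape `(±2⁸, 0¹⁶)`. -/
@[irreducible]
noncomputable def octadSigns : Finset ((_ : Finset LeechIndex) × Finset LeechIndex) :=
  octads.sigma fun O => O.powerset.filter fun A => Even A.card

theorem mem_pairSigns {p : (_ : Finset LeechIndex) × Finset LeechIndex} :
    p ∈ pairSigns ↔ p.1.card = 2 ∧ p.2 ⊆ p.1 := by
  unfold pairSigns
  rw [Finset.mem_sigma, Finset.mem_powersetCard_univ, Finset.mem_powerset]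

theorem mem_octadSigns {p : (_ : Finset LeechIndex) × Finset LeechIndex} :
    p ∈ octadSigns ↔ p.1 ∈ octads ∧ p.2 ⊆ p.1 ∧ Even p.2.card := by
  unfold octadSigns
  rw [Finset.mem_sigma, Finset.mem_filter, Finset.mem_powerset]

theorem card_pairSigns : pairSigns.card = 1104 := by
  unfold pairSigns
  rw [Finset.card_sigma]
  refine (Finset.sum_const_nat (m := 4) fun P hP => ?_).trans ?_
  · rw [Finset.card_powerset, (Finset.mem_powersetCard.1 hP).2]
    norm_num
  · rw [Finset.card_powersetCard, Finset.card_univ, card_leechIndex]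
    norm_num [Nat.choose]

theorem card_octadSigns : 97152 ≤ octadSigns.card := by
  -- `97152 = 759 * 128`: half of the `2 ^ 8` subsets of an octad have even size.
  rw [octadSigns, Finset.card_sigma, Finset.sum_const_nat (m := 128)]
  · have := card_octads
    omega
  · intro O hO
    rw [Finset.card_filter, Finset.sum_powerset_apply_card fun n => if Even n then 1 else 0,
      (mem_octads.1 hO).2]
    decide

theorem signedVector_mem_of_pairSigns {p : (_ : Finset LeechIndex) × Finset LeechIndex}
    (hp : p ∈ pairSigns) : signedVector 4 p.1 p.2 ∈ leechShell := by
  obtain ⟨P, A⟩ := p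
  rw [mem_pairSigns] at hp
  have hval : ∀ i, signedVector 4 P A i = 0 + 2 * (2 * signedVector 1 P A i) := by
    intro i
    simp only [signedVector_apply]
    split_ifs <;> norm_num
  refine ⟨⟨0, fun i => 2 * signedVector 1 P A i, ?_, ?_, hval⟩, ?_⟩
  · have h2 : (2 : ZMod 2) = 0 := rfl
    have : (fun i => ((2 * signedVector 1 P A i : ℤ) : ZMod 2)) = 0 := by
      funext i
      push_cast
      rw [h2, zero_mul]
      rfl
    rw [this]
    exact golayCode.zero_mem
  · simp only [← hval]
    rw [sum_signedVector 4 hp.2, hp.1]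
    unfold Int.ModEq
    omega
  · rw [sum_signedVector_mul_self, hp.1]
    norm_num

theorem signedVector_mem_of_octadSigns {p : (_ : Finset LeechIndex) × Finset LeechIndex}
    (hp : p ∈ octadSigns) : signedVector 2 p.1 p.2 ∈ leechShell := by
  obtain ⟨P, A⟩ := p
  rw [mem_octadSigns, mem_octads] at hp
  obtain ⟨⟨hG, h8⟩, hA, heven⟩ := hp
  have hval : ∀ i, signedVector 2 P A i = 0 + 2 * signedVector 1 P A i := by
    intro i
    simp only [signedVector_apply]
    split_ifs <;> norm_num
  refine ⟨⟨0, signedVector 1 P A, ?_, ?_, hval⟩, ?_⟩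
  · have : (fun i => (signedVector 1 P A i : ZMod 2)) = wordOf P := by
      funext i
      simp only [signedVector_apply, wordOf]
      split_ifs <;> simp
    rw [this]
    exact hG
  · simp only [← hval]
    rw [sum_signedVector 2 hA, h8]
    obtain ⟨k, hk⟩ := heven
    rw [hk]
    unfold Int.ModEq
    omega
  · rw [sum_signedVector_mul_self, h8]
    norm_num

/-- The vector with coordinate `-3` at `k` and `1` elsewhere. -/
def threeVector (k : LeechIndex) : LeechIndex → ℤ := fun i => if i = k then -3 else 1

theorem threeVector_mem (k : LeechIndex) : threeVector k ∈ leechShell := by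
  have hval : ∀ i, threeVector k i = 1 + 2 * (if i = k then -2 else 0) := by
    intro i
    unfold threeVector
    split_ifs <;> norm_num
  refine ⟨⟨1, fun i => if i = k then -2 else 0, ?_, ?_, hval⟩, ?_⟩
  · have : (fun i => ((if i = k then -2 else 0 : ℤ) : ZMod 2)) = 0 := by
      funext i
      split_ifs
      · rfl
      · simp
    rw [this]
    exact golayCode.zero_mem
  · simp only [Finset.sum_add_distrib, ← Finset.mul_sum, Finset.sum_ite_eq', Finset.mem_univ,
      if_true, Finset.sum_const, Finset.card_univ, card_leechIndex]
    rfl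
  · have : ∀ i, threeVector k i * threeVector k i = 1 + if i = k then 8 else 0 := by
      intro i
      unfold threeVector
      split_ifs <;> norm_num
    simp only [this, Finset.sum_add_distrib, Finset.sum_ite_eq', Finset.mem_univ, if_true,
      Finset.sum_const, Finset.card_univ, card_leechIndex]
    rfl

/-- Both `-3` and `1` are 1 modulo 4, so the residue 3 marks the changed signs and `O` can be
recovered. -/
theorem signChange_threeVector_mod_four (O : Finset LeechIndex) (k i : LeechIndex) :
    signChange O (threeVector k) i % 4 = 3 ↔ i ∈ O := by
  unfold signChange threeVector
  split_ifs with h1 h2 h2 <;> simp [h1]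

theorem signChange_threeVector_natAbs (O : Finset LeechIndex) (k i : LeechIndex) :
    (signChange O (threeVector k) i).natAbs = 3 ↔ i = k := by
  unfold signChange threeVector
  split_ifs with h1 h2 h2 <;> simp [h2]

theorem signChange_threeVector_injective : Function.Injective
    (fun p : Finset LeechIndex × LeechIndex => signChange p.1 (threeVector p.2)) := by
  rintro ⟨O, k⟩ ⟨O', k'⟩ h
  have h : signChange O (threeVector k) = signChange O' (threeVector k') := h
  have hO : O = O' := Finset.ext fun i => by
    rw [← signChange_threeVector_mod_four O k, ← signChange_threeVector_mod_four O' k', h]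
  have hk : k = k' := by
    rw [← signChange_threeVector_natAbs O' k', ← h]
    exact (signChange_threeVector_natAbs O k k).2 rfl
  rw [hO, hk]

/-- The shapes `(∓3, ±1²³)`, `(±2⁸, 0¹⁶)` and `(±4², 0²²)` give `24 * 4096 + 759 * 128 + 276 * 4 =
196560` vectors; residues modulo 2 and 4 tell the shapes apart. -/
theorem card_leechShell : 196560 ≤ Nat.card leechShell := by
  set F₁ := (golaySets ×ˢ (Finset.univ : Finset LeechIndex)).image
    (fun p : Finset LeechIndex × LeechIndex => signChange p.1 (threeVector p.2)) with hF₁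
  set F₂ := octadSigns.image
    (fun p : (_ : Finset LeechIndex) × Finset LeechIndex => signedVector 2 p.1 p.2) with hF₂
  set F₃ := pairSigns.image
    (fun p : (_ : Finset LeechIndex) × Finset LeechIndex => signedVector 4 p.1 p.2) with hF₃
  have c₁ : 98304 ≤ F₁.card := by
    rw [hF₁, Finset.card_image_of_injective _ signChange_threeVector_injective,
      Finset.card_product, Finset.card_univ, card_leechIndex]
    have := card_golaySets
    omega
  have c₂ : 97152 ≤ F₂.card := by
    rw [hF₂, Finset.card_image_of_injOn]
    · exact card_octadSigns
    · exact (signedVector_injOn two_pos).mono fun p hp => (mem_octadSigns.1 hp).2.1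
  have c₃ : F₃.card = 1104 := by
    rw [hF₃, Finset.card_image_of_injOn]
    · exact card_pairSigns
    · exact (signedVector_injOn four_pos).mono fun p hp => (mem_pairSigns.1 hp).2
  have h₁ : ∀ x ∈ F₁, ∀ i, x i % 2 = 1 := by
    intro x hx i
    obtain ⟨p, -, rfl⟩ := Finset.mem_image.1 hx
    unfold signChange threeVector
    split_ifs <;> rfl
  have h₂ : ∀ x ∈ F₂, (∀ i, x i % 2 = 0) ∧ ∃ i, x i % 4 = 2 := by
    intro x hx
    obtain ⟨⟨P, A⟩, hp, rfl⟩ := Finset.mem_image.1 hx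
    rw [mem_octadSigns, mem_octads] at hp
    refine ⟨fun i => ?_, ?_⟩
    · simp only [signedVector_apply]
      split_ifs <;> rfl
    · obtain ⟨i, hi⟩ := Finset.card_pos.1 (by rw [hp.1.2]; norm_num : 0 < P.card)
      refine ⟨i, ?_⟩
      simp only [signedVector_apply, hi, if_true]
      split_ifs <;> rfl
  have h₃ : ∀ x ∈ F₃, ∀ i, x i % 4 = 0 := by
    intro x hx i
    obtain ⟨p, -, rfl⟩ := Finset.mem_image.1 hx
    simp only [signedVector_apply]
    split_ifs <;> rfl
  have d₁₂ : Disjoint F₁ F₂ := Finset.disjoint_left.2 fun x hx hx' => by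
    have := h₁ x hx none
    have := (h₂ x hx').1 none
    omega
  have d₃ : Disjoint (F₁ ∪ F₂) F₃ := Finset.disjoint_left.2 fun x hx hx' => by
    rcases Finset.mem_union.1 hx with hx | hx
    · have := h₁ x hx none
      have := h₃ x hx' none
      omega
    · obtain ⟨i, hi⟩ := (h₂ x hx).2
      have := h₃ x hx' i
      omega
  have hsub : ((F₁ ∪ F₂ ∪ F₃ : Finset (LeechIndex → ℤ)) : Set (LeechIndex → ℤ)) ⊆ leechShell := by
    intro x hx
    rcases Finset.mem_union.1 (Finset.mem_coe.1 hx) with hx | hx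
    · rcases Finset.mem_union.1 hx with hx | hx
      · obtain ⟨p, hp, rfl⟩ := Finset.mem_image.1 hx
        exact (mem_golaySets.1 (Finset.mem_product.1 hp).1).isLeechIsometry.mem_leechShell
          (threeVector_mem _)
      · obtain ⟨p, hp, rfl⟩ := Finset.mem_image.1 hx
        exact signedVector_mem_of_octadSigns hp
    · obtain ⟨p, hp, rfl⟩ := Finset.mem_image.1 hx
      exact signedVector_mem_of_pairSigns hp
  have hle := Set.ncard_le_ncard hsub leechShell_finite
  rw [Set.ncard_coe_finset, Finset.card_union_of_disjoint d₃, Finset.card_union_of_disjoint d₁₂]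
    at hle
  rw [Nat.card_coe_set_eq]
  omega

/-! ### The minimal norm. -/

/-- Nonzero vectors of the Leech lattice have norm at least 32 in integral coordinates. -/
theorem IsLeech.norm_ge {x : LeechIndex → ℤ} (hx : IsLeech x) (hne : x ≠ 0) :
    32 ≤ ∑ i, x i * x i := by
  by_contra! hlt
  rcases hx.odd_or_even with hodd | ⟨y, hy, hsum, hxy⟩
  · have hmod : ∀ i, 8 ∣ x i * x i - 1 := fun i => by
      obtain ⟨k, hk⟩ := hodd i
      obtain ⟨l, hl⟩ := (Int.even_mul_succ_self k).two_dvd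
      exact ⟨l, by rw [hk]; linear_combination 4 * hl⟩
    have hnn : ∀ i, 0 ≤ x i * x i - 1 := fun i => by
      have h0 : x i ≠ 0 := fun h => by
        have := hodd i
        rw [h] at this
        exact absurd this (by decide)
      have := mul_self_pos.2 h0
      omega
    have hs : ∑ i, (x i * x i - 1) = ∑ i, x i * x i - 24 := by
      rw [Finset.sum_sub_distrib, Finset.sum_const, Finset.card_univ, card_leechIndex]
      rfl
    have h8 : 8 ∣ ∑ i, (x i * x i - 1) := Finset.dvd_sum fun i _ => hmod i
    -- Odd squares are 1 modulo 8, so the norm is a multiple of 8 that is at least 24; below 32 it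
    -- is 24, and all coordinates are `±1`.
    have h0 : ∑ i, (x i * x i - 1) = 0 := by
      have h0 : 0 ≤ ∑ i, (x i * x i - 1) := Finset.sum_nonneg fun i _ => hnn i
      omega
    rw [Finset.sum_eq_zero_iff_of_nonneg fun i _ => hnn i] at h0
    have hpm : ∀ i, x i = 1 ∨ x i = -1 := fun i => by
      have := h0 i (Finset.mem_univ i)
      exact mul_self_eq_one_iff.1 (by omega)
    obtain ⟨m, y, hy, hs, hxy⟩ := id hx
    obtain ⟨k, hk⟩ : Odd m := by
      have := hodd none
      rw [hxy, Int.odd_iff] at this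
      rw [Int.odd_iff]
      omega
    have hy' : (fun i => ((y i + k : ℤ) : ZMod 2)) ∈ golayCode := by
      have h : (fun i => ((y i + k : ℤ) : ZMod 2)) =
          (fun i => (y i : ZMod 2)) + (k : ZMod 2) • wordOf Finset.univ := by
        funext i
        simp [wordOf]
      rw [h]
      exact golayCode.add_mem hy (golayCode.smul_mem _ isGolay_univ)
    obtain ⟨s, hs, hsodd⟩ := exists_golay_odd_support hy'
    -- The entries `-1` of `x` form a Golay word. Changing their signs would put the all-ones vector
    -- in the lattice, but its sum 24 is not 4 modulo 8.
    have hones : signChange s x = fun _ => 1 := by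
      funext i
      have h1 := hsodd i
      have h2 := hxy i
      rw [Int.odd_iff] at h1
      unfold signChange
      split_ifs with h
      · have := h1.1 h
        rcases hpm i with h | h <;> omega
      · have := h1.not.1 h
        rcases hpm i with h | h <;> omega
    have hL := hs.isLeechIsometry.isLeech x hx
    rw [hones] at hL
    obtain ⟨n, z, -, hn, hz⟩ := hL
    simp only [← hz, Finset.sum_const, Finset.card_univ, card_leechIndex] at hn
    have : (1 : ℤ) = n + 2 * z none := hz none
    simp only [nsmul_eq_mul, Int.ModEq] at hn
    omega
  · have hn : ∑ i, y i * y i < 8 := by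
      have h2 : ∀ i, x i * x i = 4 * (y i * y i) := fun i => by rw [hxy]; ring
      simp only [h2, ← Finset.mul_sum] at hlt
      omega
    obtain ⟨s, hs, hodd⟩ := exists_golay_odd_support hy
    rcases s.eq_empty_or_nonempty with rfl | hsne
    · have heven : ∀ i, ∃ z, y i = 2 * z := fun i => by
        have h := (hodd i).not.1 (by simp)
        rw [Int.not_odd_iff_even] at h
        exact h.two_dvd
      choose z hz using heven
      have hn2 : ∑ i, z i * z i < 2 := by
        have h2 : ∀ i, y i * y i = 4 * (z i * z i) := fun i => by rw [hz]; ring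
        simp only [h2, ← Finset.mul_sum] at hn
        omega
      have hs2 : 2 ∣ ∑ i, z i := by
        simp only [hz, ← Finset.mul_sum] at hsum
        omega
      -- Squares keep parity, so the norm of `z` is even like its sum; being less than 2, it is 0.
      have hpar : 2 ∣ ∑ i, z i * z i - ∑ i, z i := by
        rw [← Finset.sum_sub_distrib]
        refine Finset.dvd_sum fun i _ => ?_
        have := (Int.even_mul_pred_self (z i)).two_dvd
        rwa [mul_sub, mul_one] at this
      have hnn := Finset.sum_nonneg fun i (_ : i ∈ Finset.univ) => mul_self_nonneg (z i)
      have h0 : ∑ i, z i * z i = 0 := by omega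
      rw [Finset.sum_eq_zero_iff_of_nonneg fun i _ => mul_self_nonneg _] at h0
      refine hne (funext fun i => ?_)
      rw [hxy, hz, mul_self_eq_zero.1 (h0 i (Finset.mem_univ i))]
      rfl
    · have h8 := hs.eight_le hsne
      have h1 : ∀ i ∈ s, 1 ≤ y i * y i := by
        intro i hi
        have : y i ≠ 0 := fun h => by
          have := (hodd i).1 hi
          rw [h] at this
          exact absurd this (by decide)
        have := mul_self_pos.2 this
        omega
      have h2 := Finset.card_nsmul_le_sum s _ 1 h1
      have h3 := Finset.sum_le_univ_sum_of_nonneg (s := s) fun i => mul_self_nonneg (y i)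
      simp only [nsmul_eq_mul, mul_one] at h2
      omega

/-! ### Averaging over the group, and the greedy process. -/

/-- Averaging over a finite transitive group: some translate of `S` meets `R` in at least the
expected number of points. -/
theorem exists_smul_card_filter_ge {G X : Type*} [Group G] [Finite G] [Fintype X] [DecidableEq X]
    [MulAction G X] [MulAction.IsPretransitive G X] (S R : Finset X) :
    ∃ g : G, S.card * R.card ≤ Fintype.card X * (S.filter fun s => g • s ∈ R).card := by
  classical
  have := Fintype.ofFinite G
  set n : X → X → ℕ := fun s r => (Finset.univ.filter fun g : G => g • s = r).card with hn
  -- Left multiplication by an element taking `r` to `r'` matches the two sets of group elements, so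
  -- each has `|G| / |X|` elements.
  have hconst : ∀ s r r', n s r = n s r' := by
    intro s r r'
    obtain ⟨h, rfl⟩ := MulAction.exists_smul_eq G r r'
    refine Finset.card_bij (fun g _ => h * g) (fun g hg => ?_) (fun _ _ _ _ => mul_left_cancel)
      fun g hg => ⟨h⁻¹ * g, ?_, by group⟩
    · simp only [Finset.mem_filter, Finset.mem_univ, true_and] at hg ⊢
      rw [mul_smul, hg]
    · simp only [Finset.mem_filter, Finset.mem_univ, true_and] at hg ⊢
      rw [mul_smul, hg, inv_smul_smul]
  have htotal : ∀ s r, Fintype.card X * n s r = Fintype.card G := by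
    intro s r
    have h := Finset.card_eq_sum_card_fiberwise (f := fun g : G => g • s)
      (s := Finset.univ) (t := Finset.univ) fun _ _ => Finset.mem_univ _
    rw [Finset.card_univ] at h
    rw [h, ← Finset.card_univ]
    exact (Finset.sum_const_nat fun r' _ => hconst s r' r).symm
  have hsum : ∑ g : G, Fintype.card X * (S.filter fun s => g • s ∈ R).card =
      ∑ _g : G, S.card * R.card := by
    have h1 : ∑ g : G, (S.filter fun s => g • s ∈ R).card = ∑ s ∈ S, ∑ r ∈ R, n s r := by
      simp only [Finset.card_filter, hn]
      rw [Finset.sum_comm]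
      refine Finset.sum_congr rfl fun s _ => ?_
      rw [Finset.sum_comm]
      refine Finset.sum_congr rfl fun g _ => ?_
      simp
    rw [← Finset.mul_sum, h1, Finset.mul_sum]
    simp only [Finset.mul_sum, htotal, Finset.sum_const, Finset.card_univ, smul_eq_mul]
    ring
  obtain ⟨g, -, hg⟩ := Finset.exists_le_of_sum_le (s := Finset.univ) Finset.univ_nonempty
    hsum.ge
  exact ⟨g, hg⟩

/-- The union of the first `n` sets in the greedy process that adds `N U` to the union `U`. -/
def greedyUnion {X : Type*} [DecidableEq X] (N : Finset X → Finset X) : ℕ → Finset X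
  | 0 => ∅
  | n + 1 => greedyUnion N n ∪ N (greedyUnion N n)

theorem greedyUnion_mono {X : Type*} [DecidableEq X] (N : Finset X → Finset X) :
    Monotone (greedyUnion N) :=
  monotone_nat_of_le_succ fun _ => Finset.subset_union_left

theorem subset_greedyUnion {X : Type*} [DecidableEq X] (N : Finset X → Finset X) {i j : ℕ}
    (h : i < j) : N (greedyUnion N i) ⊆ greedyUnion N j :=
  Finset.subset_union_right.trans (greedyUnion_mono N h)

theorem card_greedyUnion {X : Type*} [DecidableEq X] {N : Finset X → Finset X}
    (hN : ∀ U, Disjoint U (N U)) (n : ℕ) :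
    (greedyUnion N n).card = ∑ j ∈ Finset.range n, (N (greedyUnion N j)).card := by
  induction n with
  | zero => rfl
  | succ n ih =>
    rw [greedyUnion, Finset.card_union_of_disjoint (hN _), ih, Finset.sum_range_succ]

instance : Neg leechShell where
  neg x := ⟨-x.1, by
    refine ⟨?_, by simpa using x.2.2⟩
    have h := isGolay_univ.isLeechIsometry.isLeech x.1 x.2.1
    have : signChange Finset.univ x.1 = -x.1 := by
      funext i
      simp [signChange]
    rwa [this] at h⟩

/-- The inner product of `g • (-x)` and `g • x` is `-32`, which in the shell forces them to be
opposite. -/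
theorem shellGroup_smul_neg (g : shellGroup) (x : leechShell) : g • (-x) = -(g • x) := by
  refine Subtype.ext (eq_of_dot_eq (g • (-x)).2.2 (-(g • x)).2.2 ?_)
  have h := g.2 (-x) x
  have h1 : ∑ i, (-x).1 i * x.1 i = -32 := by
    rw [← x.2.2, ← Finset.sum_neg_distrib]
    exact Finset.sum_congr rfl fun i _ => neg_mul _ _
  have h2 : ∑ i, (g • (-x)).1 i * (-(g • x)).1 i = -∑ i, (g • (-x)).1 i * (g • x).1 i := by
    rw [← Finset.sum_neg_distrib]
    exact Finset.sum_congr rfl fun i _ => mul_neg _ _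
  rw [h2, show ∑ i, (g • (-x)).1 i * (g • x).1 i = -32 from h.trans h1]
  rfl

instance : MulAction.IsPretransitive shellGroup leechShell where
  exists_smul_eq x y := by
    obtain ⟨hx, hy, g, hg, h⟩ := shellRel_of_mem x.2 y.2
    exact ⟨⟨g, hg⟩, h⟩

/-! ### Passage to Euclidean space and assembly. -/

/-- The embedding of integral vectors, scaled by `1 / √8`. -/
noncomputable def scaledVector (x : LeechIndex → ℤ) : LeechSpace :=
  WithLp.toLp 2 fun i => (x i : ℝ) / Real.sqrt 8

theorem inner_scaledVector (x y : LeechIndex → ℤ) :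
    inner ℝ (scaledVector x) (scaledVector y) = ((∑ i, x i * y i : ℤ) : ℝ) / 8 := by
  have h8 : Real.sqrt 8 * Real.sqrt 8 = 8 := Real.mul_self_sqrt (by norm_num)
  simp only [scaledVector, PiLp.inner_apply, RCLike.inner_apply, conj_trivial]
  push_cast
  rw [Finset.sum_div]
  refine Finset.sum_congr rfl fun i _ => ?_
  rw [div_mul_div_comm, h8, mul_comm]

theorem scaledVector_injective : Function.Injective scaledVector := by
  intro x y h
  funext i
  have h1 : (x i : ℝ) / Real.sqrt 8 = (y i : ℝ) / Real.sqrt 8 := congrArg (fun v => v.ofLp i) h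
  have h2 : Real.sqrt 8 ≠ 0 := by positivity
  exact_mod_cast (div_left_inj' h2).1 h1

theorem scaledVector_neg (x : LeechIndex → ℤ) : scaledVector (-x) = -scaledVector x := by
  ext i
  simp [scaledVector, neg_div]

theorem mem_leechLattice_iff {v : LeechSpace} :
    v ∈ leechLattice ↔ ∃ x, IsLeech x ∧ scaledVector x = v := by
  constructor
  · rintro ⟨m, y, hy, hs, hv⟩
    refine ⟨fun i => m + 2 * y i, ⟨m, y, hy, hs, fun _ => rfl⟩, ?_⟩
    ext i
    exact (hv i).symm
  · rintro ⟨x, ⟨m, y, hy, hs, hx⟩, rfl⟩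
    exact ⟨m, y, hy, hs, fun i => by simp only [scaledVector, hx]⟩

theorem norm_scaledVector_sq (x : LeechIndex → ℤ) :
    ‖scaledVector x‖ ^ 2 = ((∑ i, x i * x i : ℤ) : ℝ) / 8 := by
  rw [← inner_scaledVector, real_inner_self_eq_norm_sq]

/-- The lower bound 32 for nonzero lattice vectors is attained, for instance by `threeVector none`.
-/
theorem leechMinimalVectors_eq : leechMinimalVectors = scaledVector '' leechShell := by
  have hzero : scaledVector 0 = 0 := by ext i; simp [scaledVector]
  ext v
  constructor
  · rintro ⟨hv, hv0, hmin⟩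
    obtain ⟨x, hx, rfl⟩ := mem_leechLattice_iff.1 hv
    refine ⟨x, ⟨hx, le_antisymm ?_ (hx.norm_ge fun h => hv0 (h ▸ hzero))⟩, rfl⟩
    have ht := threeVector_mem none
    have hle := hmin (scaledVector (threeVector none)) (mem_leechLattice_iff.2 ⟨_, ht.1, rfl⟩)
      fun h => by
        have := congrFun (scaledVector_injective (h.trans hzero.symm)) none
        simp [threeVector] at this
    have hsq := pow_le_pow_left₀ (norm_nonneg _) hle 2
    rw [norm_scaledVector_sq, norm_scaledVector_sq, ht.2] at hsq
    have := (div_le_div_iff_of_pos_right (by norm_num : (0 : ℝ) < 8)).1 hsq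
    exact_mod_cast this
  · rintro ⟨x, hx, rfl⟩
    refine ⟨mem_leechLattice_iff.2 ⟨x, hx.1, rfl⟩, fun h => ?_, fun w hw hw0 => ?_⟩
    · have h0 : x = 0 := scaledVector_injective (h.trans hzero.symm)
      have := hx.2
      simp [h0] at this
    · obtain ⟨z, hz, rfl⟩ := mem_leechLattice_iff.1 hw
      refine le_of_sq_le_sq ?_ (norm_nonneg _)
      rw [norm_scaledVector_sq, norm_scaledVector_sq, hx.2]
      have := hz.norm_ge fun h => hw0 (h ▸ hzero)
      gcongr

/-- The greedy choice of disjoint translates of a set of shell vectors. -/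
theorem exists_disjoint_translates (S : Finset leechShell) :
    ∃ N : Finset leechShell → Finset leechShell, N ∅ = S ∧ (∀ U, Disjoint U (N U)) ∧
      (∀ U, (S.card : ℝ) * (1 - (U.card : ℝ) / 196560) ≤ (N U).card) ∧
      ∀ U, ∃ g : shellGroup, ∀ x, x ∈ N U ↔ g⁻¹ • x ∈ S ∧ x ∉ U := by
  classical
  have := Fintype.ofFinite leechShell
  choose g hg using fun U : Finset leechShell =>
    exists_smul_card_filter_ge (G := shellGroup) S Uᶜ
  -- The identity is chosen for the empty union so that the process starts with `S` itself rather
  -- than a translate.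
  set h : Finset leechShell → shellGroup := fun U => if U = ∅ then 1 else g U with hh
  set N : Finset leechShell → Finset leechShell := fun U =>
    (S.filter fun s => h U • s ∈ Uᶜ).image (h U • ·) with hN
  have hcard : ∀ U, (N U).card = (S.filter fun s => h U • s ∈ Uᶜ).card := fun U =>
    Finset.card_image_of_injective _ (MulAction.injective _)
  have hmem : ∀ U x, x ∈ N U ↔ (h U)⁻¹ • x ∈ S ∧ x ∉ U := by
    intro U x
    simp only [hN, Finset.mem_image, Finset.mem_filter, Finset.mem_compl]
    constructor
    · rintro ⟨s, ⟨hs, hsU⟩, rfl⟩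
      rw [inv_smul_smul]
      exact ⟨hs, hsU⟩
    · rintro ⟨hs, hx⟩
      exact ⟨_, ⟨hs, by rwa [smul_inv_smul]⟩, smul_inv_smul _ _⟩
  have hempty : N ∅ = S := by
    ext x
    rw [hmem]
    simp [hh]
  refine ⟨N, hempty, fun U => Finset.disjoint_right.2 fun x hx => ((hmem U x).1 hx).2,
    fun U => ?_, fun U => ⟨h U, hmem U⟩⟩
  by_cases hU : U = ∅
  · rw [hU, hempty]
    simp
  have hle := hg U
  have hhU : h U = g U := if_neg hU
  rw [← hhU, ← hcard, Finset.card_compl] at hle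
  have hX : 196560 ≤ Fintype.card leechShell := by
    rw [← Nat.card_eq_fintype_card]
    exact card_leechShell
  have hUX := Finset.card_le_univ U
  have hX' : (196560 : ℝ) ≤ Fintype.card leechShell := by exact_mod_cast hX
  have hle' : (S.card : ℝ) * (Fintype.card leechShell - U.card) ≤
      Fintype.card leechShell * (N U).card := by
    rw [← Nat.cast_sub hUX]
    exact_mod_cast hle
  have hpos : (0 : ℝ) < Fintype.card leechShell := by linarith
  calc (S.card : ℝ) * (1 - (U.card : ℝ) / 196560)
      ≤ S.card * (1 - (U.card : ℝ) / Fintype.card leechShell) := by gcongr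
    _ = S.card * (Fintype.card leechShell - U.card) / Fintype.card leechShell := by
        field_simp
    _ ≤ (N U).card := by
        rw [div_le_iff₀ hpos]
        linarith

theorem mainTheorem11 (S : Set LeechSpace) (hS : S ⊆ leechMinimalVectors) (hS1 : InnerLeOne S) :
    ∃ T : ℕ → Finset LeechSpace,
      (T 1 : Set LeechSpace) = S ∧
      (∀ i, 1 ≤ i → (T i : Set LeechSpace) ⊆ leechMinimalVectors) ∧
      (∀ i j, 1 ≤ i → 1 ≤ j → i ≠ j → Disjoint (T i) (T j)) ∧
      (∀ i, 1 ≤ i → InnerLeOne (T i : Set LeechSpace)) ∧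
      (∀ i, 1 ≤ i →
        ((T i).card : ℝ) ≥
          (S.ncard : ℝ) * (1 - (∑ j ∈ Finset.Ico 1 i, ((T j).card : ℝ)) / 196560)) ∧
      (IsAntipodal S → ∀ i, 1 ≤ i → IsAntipodal (T i : Set LeechSpace)) := by
  classical
  have := Fintype.ofFinite leechShell
  let ι : leechShell ↪ LeechSpace :=
    ⟨fun x => scaledVector x.1, fun _ _ h => Subtype.ext (scaledVector_injective h)⟩
  set S' : Finset leechShell := Finset.univ.filter fun x => ι x ∈ S with hS'
  have hmemS' : ∀ x, x ∈ S' ↔ ι x ∈ S := by simp [hS']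
  have hmap : (S'.map ι : Set LeechSpace) = S := by
    ext v
    simp only [Finset.coe_map, Set.mem_image, Finset.mem_coe, hmemS']
    constructor
    · rintro ⟨x, hx, rfl⟩
      exact hx
    · intro hv
      obtain ⟨x, hx, rfl⟩ := leechMinimalVectors_eq ▸ hS hv
      exact ⟨⟨x, hx⟩, hv, rfl⟩
  have hcardS : S.ncard = S'.card := by
    rw [← hmap, Set.ncard_coe_finset, Finset.card_map]
  obtain ⟨N, hN0, hNdisj, hNcard, hNmem⟩ := exists_disjoint_translates S'
  have hdisj : ∀ i j, i < j → Disjoint (N (greedyUnion N i)) (N (greedyUnion N j)) :=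
    fun i j hij => Finset.disjoint_of_subset_left (subset_greedyUnion N hij) (hNdisj _)
  -- The index is shifted so that the sets start at 1. Index 0 repeats the set of index 1, as `0 - 1
  -- = 0`, which the condition `1 ≤ i` excludes.
  refine ⟨fun i => (N (greedyUnion N (i - 1))).map ι, ?_, ?_, ?_, ?_, ?_, ?_⟩
  · change ((N ∅).map ι : Set LeechSpace) = S
    rw [hN0, hmap]
  · intro i _ v hv
    obtain ⟨x, -, rfl⟩ := Finset.mem_map.1 (Finset.mem_coe.1 hv)
    rw [leechMinimalVectors_eq]
    exact ⟨x.1, x.2, rfl⟩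
  · intro i j hi hj hij
    rw [Finset.disjoint_map]
    rcases lt_or_gt_of_ne hij with h | h
    · exact hdisj _ _ (by omega)
    · exact (hdisj _ _ (by omega)).symm
  · intro i _ v hv w hw hvw
    obtain ⟨x, hx, rfl⟩ := Finset.mem_map.1 (Finset.mem_coe.1 hv)
    obtain ⟨y, hy, rfl⟩ := Finset.mem_map.1 (Finset.mem_coe.1 hw)
    obtain ⟨g, hg⟩ := hNmem (greedyUnion N (i - 1))
    rw [hg, hmemS'] at hx hy
    have h := hS1 _ hx.1 _ hy.1 fun h =>
      hvw (congrArg ι (MulAction.injective g⁻¹ (ι.injective h)))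
    change inner ℝ (scaledVector _) (scaledVector _) ≤ 1
    change inner ℝ (scaledVector _) (scaledVector _) ≤ 1 at h
    rw [inner_scaledVector] at h ⊢
    rwa [show ∑ i, (g⁻¹ • x).1 i * (g⁻¹ • y).1 i = ∑ i, x.1 i * y.1 i from (g⁻¹).2 x y] at h
  · intro i hi
    simp only [Finset.card_map]
    have h := hNcard (greedyUnion N (i - 1))
    have hsum : ∑ j ∈ Finset.Ico 1 i, ((N (greedyUnion N (j - 1))).card : ℝ) =
        (greedyUnion N (i - 1)).card := by
      rw [card_greedyUnion hNdisj, Finset.sum_Ico_eq_sum_range]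
      push_cast
      exact Finset.sum_congr rfl fun j _ => by rw [Nat.add_sub_cancel_left]
    rw [hsum, hcardS]
    exact h
  · intro hanti
    have hS'neg : ∀ x ∈ S', -x ∈ S' := by
      intro x hx
      rw [hmemS'] at hx ⊢
      have h : ι (-x) = -ι x := scaledVector_neg x.1
      rw [h]
      exact hanti _ hx
    -- Removing `U` from an antipodal translate keeps it antipodal only if `U` is antipodal, hence
    -- the induction on the unions below.
    have hNneg : ∀ U : Finset leechShell, (∀ x ∈ U, -x ∈ U) → ∀ x ∈ N U, -x ∈ N U := by
      intro U hU x hx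
      obtain ⟨g, hg⟩ := hNmem U
      rw [hg] at hx ⊢
      rw [shellGroup_smul_neg]
      refine ⟨hS'neg _ hx.1, fun h => hx.2 ?_⟩
      have hxx : - -x = x := Subtype.ext (neg_neg x.1)
      exact hxx ▸ hU _ h
    have hUneg : ∀ n, ∀ x ∈ greedyUnion N n, -x ∈ greedyUnion N n := by
      intro n
      induction n with
      | zero => exact fun x hx => absurd hx (Finset.notMem_empty x)
      | succ n ih =>
        intro x hx
        rcases Finset.mem_union.1 hx with h | h
        · exact Finset.mem_union_left _ (ih x h)
        · exact Finset.mem_union_right _ (hNneg _ ih x h)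
    intro i _ v hv
    obtain ⟨x, hx, rfl⟩ := Finset.mem_map.1 (Finset.mem_coe.1 hv)
    refine Finset.mem_coe.2 (Finset.mem_map.2 ⟨-x, hNneg _ (hUneg _) x hx, ?_⟩)
    exact scaledVector_neg x.1
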